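/- Let $V$ be a finite-dimensional complex vector space and let $W < \mathrm{GL}(V)$ be a finite reflection group, that is, a finite group generated by (pseudo-)reflections: elements of finite order whose fixed space is a hyperplane. Let $\mathcal{A}$ be the set of the hyperplanes fixed by the reflections in $W$, let $X = V \setminus \bigcup_{H \in \mathcal{A}} H$, and let $W$ act diagonally on $X \times V$, $w\cdot(x,v) = (w x, w v)$. Then $W$ acts freely on $X$, so that $X/W$ and $(X\times V)/W$ are complex manifolds (charts being given by local inverses of the quotient maps) and the fibres $\{[x,v] : v \in V\}$ of $(X \times V)/W \to X/W$ are vector spaces. The quotient bundle $(X \times V \to X)/W$ is holomorphically equivalent to the trivial bundle $(X/W) \times V \to X/W$: there is a biholomorphic map $(X \times V)/W \to (X/W) \times V$ which commutes with the projections to $X/W$ and is linear on every fibre. More precisely, identify $V$ with $\mathbb{C}^n$ by the choice of a basis. Then there are basic invariants of $W$, i.e. $n$ algebraically independent polynomial functions $f_1,\dots,f_n$ on $V$ which generate the algebra $\mathbb{C}[V]^W$; and for every choice of basic invariants, with $f = (f_1,\dots,f_n) : V \to \mathbb{C}^n = V$ and $\mathrm{d}_x f$ its differential at $x$, the map $$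 [x,v] \longmapsto ([x], \mathrm{d}_x f(v)) $$ is well defined and is such a holomorphic equivalence. -/

import Mathlib

open scoped Manifold ContDiff

namespace ReflBundle

section groups

variable {V : Type*} [AddCommGroup V] [Module ℂ V]

/-- The subspace of vectors fixed by `s`, i.e. `ker (s - 1)`. -/
def fixedSpace (s : LinearMap.GeneralLinearGroup ℂ V) : Submodule ℂ V :=
  LinearMap.ker ((s : V →ₗ[ℂ] V) - LinearMap.id)

/-- A (pseudo-)reflection: an element of `GL(V)` of finite order whose space of fixed vectors is a
hyperplane, i.e. has codimension exactly `1` (so the identity is not a reflection). -/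
def IsReflection (s : LinearMap.GeneralLinearGroup ℂ V) : Prop :=
  IsOfFinOrder s ∧ Module.finrank ℂ (fixedSpace s) + 1 = Module.finrank ℂ V

/-- A subgroup of `GL(V)` is a reflection group if it is generated by the reflections it contains
(finiteness is assumed separately). -/
def IsReflectionGroup (W : Subgroup (LinearMap.GeneralLinearGroup ℂ V)) : Prop :=
  Subgroup.closure {s | s ∈ W ∧ IsReflection s} = W

/-- The hyperplane arrangement of `W`: the set of the hyperplanes fixed by the reflections
in `W`. -/
def arrangement (W : Subgroup (LinearMap.GeneralLinearGroup ℂ V)) : Set (Submodule ℂ V) :=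
  {H | ∃ s ∈ W, IsReflection s ∧ H = fixedSpace s}

theorem mem_fixedSpace (s : LinearMap.GeneralLinearGroup ℂ V) (v : V) :
    v ∈ fixedSpace s ↔ s • v = v := by
  simp [fixedSpace, sub_eq_zero, Units.smul_def]

theorem arrangement_finite (W : Subgroup (LinearMap.GeneralLinearGroup ℂ V)) [Finite W] :
    (arrangement W).Finite := by
  refine (Set.finite_range
    (fun s : W => fixedSpace (s : LinearMap.GeneralLinearGroup ℂ V))).subset ?_
  rintro H ⟨s, hs, -, rfl⟩
  exact ⟨⟨s, hs⟩, rfl⟩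

theorem isReflection_conj (w s : LinearMap.GeneralLinearGroup ℂ V) (hs : IsReflection s) :
    IsReflection (w * s * w⁻¹) := by
  refine ⟨(isConj_iff.2 ⟨w, rfl⟩ : IsConj s (w * s * w⁻¹)).isOfFinOrder hs.1, ?_⟩
  have key : fixedSpace (w * s * w⁻¹) = (fixedSpace s).map
      (LinearMap.GeneralLinearGroup.toLinearEquiv w : V →ₗ[ℂ] V) := by
    ext v
    rw [mem_fixedSpace, Submodule.mem_map]
    constructor
    · intro h
      refine ⟨w⁻¹ • v, ?_, ?_⟩
      · rw [mem_fixedSpace, eq_inv_smul_iff, ← mul_smul, ← mul_smul, h]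
      · exact smul_inv_smul w v
    · rintro ⟨u, hu, rfl⟩
      rw [mem_fixedSpace] at hu
      change (w * s * w⁻¹) • (w • u) = w • u
      rw [mul_smul, inv_smul_smul, mul_smul, hu]
  rw [key, LinearEquiv.finrank_map_eq, hs.2]

/-- The action of `w ∈ W` permutes the hyperplanes of the arrangement. -/
theorem smul_mem_iUnion_arrangement {W : Subgroup (LinearMap.GeneralLinearGroup ℂ V)} (w : W)
    {v : V} (hv : w • v ∈ ⋃ H ∈ arrangement W, (H : Set V)) :
    v ∈ ⋃ H ∈ arrangement W, (H : Set V) := by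
  simp only [Set.mem_iUnion] at hv ⊢
  obtain ⟨_, ⟨s, hsW, hs, rfl⟩, h⟩ := hv
  have h' : s • ((w : LinearMap.GeneralLinearGroup ℂ V) • v) =
      (w : LinearMap.GeneralLinearGroup ℂ V) • v := (mem_fixedSpace _ _).1 h
  refine ⟨_, ⟨(w⁻¹ : W) * s * (w⁻¹ : W)⁻¹,
    W.mul_mem (W.mul_mem (SetLike.coe_mem _) hsW) (W.inv_mem (SetLike.coe_mem _)),
    isReflection_conj _ _ hs, rfl⟩, ?_⟩
  refine (mem_fixedSpace _ _).2 ?_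
  rw [InvMemClass.coe_inv, inv_inv, mul_smul, mul_smul, h', inv_smul_smul]

end groups

section bundle

variable {V : Type*} [NormedAddCommGroup V] [NormedSpace ℂ V] [FiniteDimensional ℂ V]
variable (W : Subgroup (LinearMap.GeneralLinearGroup ℂ V)) [Finite W]

/-- The hyperplane complement `X = V \ ⋃ 𝒜`, as an open subset of `V`. -/
def hyperplaneComplement : TopologicalSpace.Opens V where
  carrier := (⋃ H ∈ arrangement W, (H : Set V))ᶜ
  is_open' := by
    rw [isOpen_compl_iff]
    exact (arrangement_finite W).isClosed_biUnion fun H _ => H.closed_of_finiteDimensional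

/-- `W` acts on `X` by restriction of its action on `V`. -/
instance instMulActionComplement : MulAction W (hyperplaneComplement W) where
  smul w x := ⟨w • (x : V), fun h => x.2 (smul_mem_iUnion_arrangement w h)⟩
  one_smul x := Subtype.ext (one_smul W (x : V))
  mul_smul w w' x := Subtype.ext (mul_smul w w' (x : V))

theorem coe_smul (w : W) (x : hyperplaneComplement W) :
    ((w • x : hyperplaneComplement W) : V) = w • (x : V) := rfl

instance instContinuousConstSMul : ContinuousConstSMul W V where
  continuous_const_smul w := LinearMap.continuous_of_finiteDimensional
    ((w : LinearMap.GeneralLinearGroup ℂ V) : V →ₗ[ℂ] V)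

instance instContinuousConstSMulComplement :
    ContinuousConstSMul W (hyperplaneComplement W) where
  continuous_const_smul w :=
    ((continuous_const_smul w).comp continuous_subtype_val).subtype_mk _

instance instLocallyCompactComplement : LocallyCompactSpace (hyperplaneComplement W) :=
  haveI : ProperSpace V := FiniteDimensional.proper_rclike ℂ V
  (hyperplaneComplement W).isOpen.locallyCompactSpace

instance instLocallyCompactProd : LocallyCompactSpace (hyperplaneComplement W × V) :=
  haveI : ProperSpace V := FiniteDimensional.proper_rclike ℂ V
  inferInstance

/-- If `W` acts freely on `X` then it acts freely on `X × V` (diagonal action). -/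
instance instIsCancelSMulProd [IsCancelSMul W (hyperplaneComplement W)] :
    IsCancelSMul W (hyperplaneComplement W × V) where
  left_cancel' w _ _ h := MulAction.injective w h
  right_cancel' w w' p h := IsCancelSMul.right_cancel w w' p.1 (congrArg Prod.fst h)

/-- The base `X / W`. It has the quotient topology and, when the action is free, Mathlib's
charted space structure, whose charts are charts of `X` composed with local inverses of
`X → X / W`. -/
abbrev Base : Type _ := MulAction.orbitRel.Quotient W (hyperplaneComplement W)

/-- The total space `(X × V) / W` of the quotient bundle, for the diagonal action
`w • (x, v) = (w • x, w • v)`. Topology and charts are as for `Base`. -/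
abbrev Total : Type _ := MulAction.orbitRel.Quotient W (hyperplaneComplement W × V)

/-- The class of `x` in `X / W`. -/
def mkBase (x : hyperplaneComplement W) : Base W := Quotient.mk _ x

/-- The class of `(x, v)` in `(X × V) / W`. -/
def mkTotal (x : hyperplaneComplement W) (v : V) : Total W := Quotient.mk _ (x, v)

/-- The bundle projection `(X × V) / W → X / W`, `[x, v] ↦ [x]`. -/
def proj : Total W → Base W :=
  Quotient.map Prod.fst (by rintro _ p ⟨w, rfl⟩; exact ⟨w, rfl⟩)

/-- The fibre of the quotient bundle over `q`. -/
def Fibre (q : Base W) : Type _ := {e : Total W // proj W e = q}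

section fibres

variable [IsCancelSMul W (hyperplaneComplement W)]

/-- For a free action, and `x` in the class `q`, the map `v ↦ [x, v]` is a bijection of `V` onto
the fibre over `q`. -/
noncomputable def fibreEquiv {q : Base W} (x : hyperplaneComplement W) (hx : mkBase W x = q) :
    V ≃ Fibre W q :=
  Equiv.ofBijective (fun v => ⟨mkTotal W x v, hx⟩) <| by
    constructor
    · intro v v' h
      obtain ⟨w, hw⟩ := Quotient.exact (congrArg Subtype.val h)
      have h1 : w • x = x := congrArg Prod.fst hw
      have h2 : w • v' = v := congrArg Prod.snd hw
      have h3 : w = 1 := IsCancelSMul.right_cancel w 1 x (by rw [h1, one_smul])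
      rw [← h2, h3, one_smul]
    · rintro ⟨e, he⟩
      induction e using Quotient.inductionOn with
      | h p =>
        obtain ⟨w, hw⟩ := Quotient.exact (hx.trans he.symm)
        exact ⟨w • p.2, Subtype.ext (Quotient.sound ⟨w, Prod.ext hw rfl⟩)⟩

/-- The vector space structure of the fibre over `q`, transported from `V` by `v ↦ [x, v]` for a
representative `x` of `q`; by `fibreLinearEquiv` it does not depend on the representative. -/
noncomputable instance instAddCommGroupFibre (q : Base W) : AddCommGroup (Fibre W q) :=
  (fibreEquiv W q.out q.out_eq).symm.addCommGroup

noncomputable instance instModuleFibre (q : Base W) : Module ℂ (Fibre W q) :=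
  (fibreEquiv W q.out q.out_eq).symm.module ℂ

/-- For every `x` in the class `q`, the bijection `v ↦ [x, v]` of `V` onto the fibre over `q` is
linear. -/
theorem fibreEquiv_isLinearMap {q : Base W} (x : hyperplaneComplement W)
    (hx : mkBase W x = q) : IsLinearMap ℂ (fibreEquiv W x hx) := by
  obtain ⟨w, hw⟩ : ∃ w : W, w • x = q.out := Quotient.exact (q.out_eq.trans hx.symm)
  have key : ∀ v, fibreEquiv W x hx v =
      ((fibreEquiv W q.out q.out_eq).symm.linearEquiv ℂ).symm (w • v) := fun v =>
    Subtype.ext (Quotient.sound ⟨w⁻¹, Prod.ext (by simp [← hw]) (inv_smul_smul w v)⟩)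
  constructor
  · intro u v
    rw [key, key, key, smul_add, map_add]
  · intro c v
    rw [key, key, smul_comm, map_smul]

/-- A holomorphic trivialization of the quotient bundle `(X × V) / W → X / W`: an isomorphism of
holomorphic vector bundles onto the trivial bundle `(X / W) × V → X / W`. It is a biholomorphic map
of the total spaces which commutes with the projections to `X / W` and is linear on every fibre.
(Biholomorphic is expressed as analytic over `ℂ` with analytic inverse.) -/
structure HolomorphicTrivialization where
  /-- the biholomorphic map of total spaces -/
  toDiffeomorph : Total W ≃ₘ^ω⟮𝓘(ℂ, V).prod 𝓘(ℂ, V), 𝓘(ℂ, V).prod 𝓘(ℂ, V)⟯ (Base W × V)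
  /-- it covers the identity of `X / W` -/
  fst_apply : ∀ e : Total W, (toDiffeomorph e).1 = proj W e
  /-- it is linear on the fibres -/
  linear : ∀ q : Base W, IsLinearMap ℂ (fun e : Fibre W q => (toDiffeomorph e.1).2)

end fibres

end bundle

section invariants

variable (V : Type*) [AddCommGroup V] [Module ℂ V]

/-- The algebra `ℂ[V] = S(V*)` of polynomial functions on `V`: the algebra of functions generated
by the linear forms. -/
def polyFun : Subalgebra ℂ (V → ℂ) :=
  Algebra.adjoin ℂ {g | ∃ φ : Module.Dual ℂ V, g = φ}

variable {V}

/-- The algebra `ℂ[V]^W` of `W`-invariant polynomial functions on `V`. -/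
def invariantAlgebra (W : Subgroup (LinearMap.GeneralLinearGroup ℂ V)) :
    Subalgebra ℂ (V → ℂ) where
  carrier := {g | g ∈ polyFun V ∧ ∀ (w : W) (v : V), g (w • v) = g v}
  mul_mem' hg hh := ⟨mul_mem hg.1 hh.1, fun w v => by simp [hg.2 w v, hh.2 w v]⟩
  add_mem' hg hh := ⟨add_mem hg.1 hh.1, fun w v => by simp [hg.2 w v, hh.2 w v]⟩
  algebraMap_mem' c := ⟨Subalgebra.algebraMap_mem _ c, fun _ _ => rfl⟩

/-- Basic invariants of `W`: algebraically independent functions `f₁, …, fₙ` which generate the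
algebra `ℂ[V]^W`. -/
def IsBasicInvariants (W : Subgroup (LinearMap.GeneralLinearGroup ℂ V)) {n : ℕ}
    (f : Fin n → V → ℂ) : Prop :=
  AlgebraicIndependent ℂ f ∧ Algebra.adjoin ℂ (Set.range f) = invariantAlgebra W

end invariants

end ReflBundle

/-! Everything rests on one fact: for basic invariants `f` the differential `d_x f` is invertible at
every point `x` of `X`. Differentiating `f (w y) = f y` gives `d_{wx} f (w v) = d_x f (v)`, so `[x,
v] ↦ ([x], d_x f (v))` is well defined; given invertibility, `([x], u) ↦ [x, (d_x f)⁻¹ u]` is its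
inverse. Both maps are holomorphic because they are so upstairs and the quotient maps are local
biholomorphisms.

Invertibility is a statement about the zeros of the Jacobian determinant `J`. At a point with
trivial stabilizer, averaging a suitable polynomial over `W` produces invariants whose differentials
separate vectors (`exists_invariant_fderiv_ne_zero`); since `f` generates the invariants, `J` does
not vanish there. Hence the zeros of `J` lie in the finite union of the subspaces `Fix w` with `w ≠
1`, and in particular `J ≠ 0`. The zero set is then a hypersurface, so each of its irreducible
components lies in a single `Fix w`, of codimension one (`exists_finrank_le_of_zeros_subset`). Such
a `w` is a reflection, so `J` vanishes only on the arrangement (`eq_zero_of_fderiv_eq_zero`).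
Freeness on `X` is not used here but follows: if `w x = x`, then `d_x f ∘ w = d_x f`, so `w = 1`.

Basic invariants exist by Chevalley's argument. A minimal set of homogeneous generators of the ideal
spanned by the invariants of positive degree generates the algebra of invariants, by averaging, and
is algebraically independent, by a lemma on relations combined with Euler's identity. There are `n`
of them because the polynomial ring is integral over its invariants. -/

namespace MvPolynomial

/-! ### Homogeneous polynomials, the chain rule and weighted degrees. -/

section Homogeneous

variable {σ k : Type*} [Field k]

attribute [local instance] MvPolynomial.gradedAlgebra in
theorem homogeneousComponent_mul_of_isHomogeneous {f : MvPolynomial σ k} {e : ℕ}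
    (hf : f.IsHomogeneous e) (c : MvPolynomial σ k) (d : ℕ) :
    homogeneousComponent d (c * f) =
      if e ≤ d then homogeneousComponent (d - e) c * f else 0 := by
  have h := DirectSum.coe_decompose_mul_of_right_mem (homogeneousSubmodule σ k) (a := c) d
    ((mem_homogeneousSubmodule e f).2 hf)
  simpa only [← DirectSum.Decomposition.decompose'_eq, decomposition.decompose'_apply] using h

/-- Taking components of degree `d + 1` replaces `q` by its component of degree `d`; then `l`
cancels. -/
theorem IsHomogeneous.of_mul_left {l q : MvPolynomial σ k} {d : ℕ} (hl : l.IsHomogeneous 1)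
    (hl0 : l ≠ 0) (h : (l * q).IsHomogeneous (d + 1)) : q.IsHomogeneous d := by
  have h1 := homogeneousComponent_mul_of_isHomogeneous hl q (d + 1)
  rw [if_pos (Nat.le_add_left 1 d), Nat.add_sub_cancel, mul_comm q l,
    homogeneousComponent_eq_self h, mul_comm _ l] at h1
  rw [mul_left_cancel₀ hl0 h1]
  exact homogeneousComponent_isHomogeneous d q

/-- A homogeneous combination of homogeneous elements may be written with homogeneous
coefficients. -/
theorem exists_homogeneous_coeff {ι : Type*} {T : Finset ι} {G : ι → MvPolynomial σ k} {e : ι → ℕ}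
    (hG : ∀ i ∈ T, (G i).IsHomogeneous (e i)) {g : MvPolynomial σ k} {d : ℕ}
    (hg : g.IsHomogeneous d) {a : ι → MvPolynomial σ k} (ha : g = ∑ i ∈ T, a i * G i) :
    ∃ h : ι → MvPolynomial σ k, g = ∑ i ∈ T, h i * G i ∧
      ∀ i, h i = 0 ∨ e i ≤ d ∧ (h i).IsHomogeneous (d - e i) := by
  refine ⟨fun i => if e i ≤ d then homogeneousComponent (d - e i) (a i) else 0, ?_, fun i => ?_⟩
  · conv_lhs => rw [← homogeneousComponent_eq_self hg, ha, map_sum]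
    refine Finset.sum_congr rfl fun i hi => ?_
    rw [homogeneousComponent_mul_of_isHomogeneous (hG i hi), ite_mul, zero_mul]
  · dsimp only
    split_ifs with h
    · exact Or.inr ⟨h, homogeneousComponent_isHomogeneous _ _⟩
    · exact Or.inl rfl

theorem pderiv_aeval {τ : Type*} [Fintype τ] (f : τ → MvPolynomial σ k) (t : σ)
    (H : MvPolynomial τ k) :
    pderiv t (aeval f H) = ∑ i, aeval f (pderiv i H) * pderiv t (f i) := by
  classical
  induction H using MvPolynomial.induction_on with
  | C a => simp [← MvPolynomial.algebraMap_eq]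
  | add p q hp hq => simp only [map_add, hp, hq, add_mul, Finset.sum_add_distrib]
  | mul_X p j hp =>
    simp only [map_mul, aeval_X, Derivation.leibniz, smul_eq_mul, hp, map_add, add_mul,
      Finset.sum_add_distrib, pderiv_X, Finset.mul_sum]
    congr 1
    · rw [Finset.sum_eq_single j (by intro i _ hi; simp [hi.symm]) (by simp)]
      simp
    · exact Finset.sum_congr rfl fun i _ => by ring

theorem IsWeightedHomogeneous.aeval_isHomogeneous {τ : Type*} {f : τ → MvPolynomial σ k}
    {e : τ → ℕ} (hf : ∀ i, (f i).IsHomogeneous (e i)) {H : MvPolynomial τ k} {D : ℕ}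
    (hH : H.IsWeightedHomogeneous e D) : (aeval f H).IsHomogeneous D := by
  rw [aeval_def, eval₂_eq]
  refine IsHomogeneous.sum _ _ _ fun m hm => ?_
  have hm' : Finsupp.weight e m = D := hH (mem_support_iff.1 hm)
  have h1 : (∏ i ∈ m.support, f i ^ m i).IsHomogeneous (∑ i ∈ m.support, e i * m i) :=
    IsHomogeneous.prod _ _ _ fun i _ => (hf i).pow (m i)
  have h2 : ∑ i ∈ m.support, e i * m i = D := by
    rw [← hm', Finsupp.weight_apply, Finsupp.sum]
    exact Finset.sum_congr rfl fun i _ => by rw [smul_eq_mul, mul_comm]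
  rw [h2] at h1
  exact h1.C_mul _

end Homogeneous

/-! ### The Reynolds operator and Chevalley's lemma. -/

section Invariants

variable {σ k G : Type*} [Field k] [Group G]
  (ρ : G →* (MvPolynomial σ k →ₐ[k] MvPolynomial σ k))

/-- The Reynolds operator: the average of the translates of a polynomial. -/
noncomputable def reynolds [Fintype G] : MvPolynomial σ k →ₗ[k] MvPolynomial σ k :=
  (Fintype.card G : k)⁻¹ • ∑ g, (ρ g).toLinearMap

theorem reynolds_apply [Fintype G] (p : MvPolynomial σ k) :
    reynolds ρ p = (Fintype.card G : k)⁻¹ • ∑ g, ρ g p := by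
  simp [reynolds]

theorem apply_reynolds [Fintype G] (g : G) (p : MvPolynomial σ k) :
    ρ g (reynolds ρ p) = reynolds ρ p := by
  rw [reynolds_apply, map_smul, map_sum]
  congr 1
  refine Fintype.sum_bijective (g * ·) (Group.mulLeft_bijective g) _ _ fun h => ?_
  rw [map_mul, AlgHom.mul_apply]

theorem reynolds_eq_self [CharZero k] [Fintype G] {p : MvPolynomial σ k} (hp : ∀ g, ρ g p = p) :
    reynolds ρ p = p := by
  rw [reynolds_apply, Finset.sum_congr rfl fun g _ => hp g, Finset.sum_const, Finset.card_univ,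
    ← Nat.cast_smul_eq_nsmul k, smul_smul, inv_mul_cancel₀ (by simp), one_smul]

theorem reynolds_mul [Fintype G] (p : MvPolynomial σ k) {f : MvPolynomial σ k}
    (hf : ∀ g, ρ g f = f) :
    reynolds ρ (p * f) = reynolds ρ p * f := by
  simp only [reynolds_apply, map_mul, hf, ← Finset.sum_mul, smul_mul_assoc]

theorem reynolds_sub_mem [CharZero k] [Fintype G] {I : Ideal (MvPolynomial σ k)} {p : MvPolynomial σ k}
    (h : ∀ g, ρ g p - p ∈ I) : reynolds ρ p - p ∈ I := by
  have h1 : reynolds ρ p - p = C (Fintype.card G : k)⁻¹ * ∑ g, (ρ g p - p) := by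
    rw [Finset.sum_sub_distrib, mul_sub, ← smul_eq_C_mul, ← smul_eq_C_mul, ← reynolds_apply,
      Finset.sum_const, Finset.card_univ, ← Nat.cast_smul_eq_nsmul k, smul_smul,
      inv_mul_cancel₀ (by simp), one_smul]
  rw [h1]
  exact I.mul_mem_left _ (I.sum_mem fun g _ => h g)

theorem isHomogeneous_reynolds [Fintype G]
    (hρ : ∀ g p d, IsHomogeneous p d → IsHomogeneous (ρ g p) d)
    {p : MvPolynomial σ k} {d : ℕ} (hp : p.IsHomogeneous d) : (reynolds ρ p).IsHomogeneous d := by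
  rw [reynolds_apply, smul_eq_C_mul]
  exact (IsHomogeneous.sum _ _ _ fun g _ => hρ g p d hp).C_mul _

/-- The homogeneous invariants of positive degree. -/
def positiveInvariants : Set (MvPolynomial σ k) :=
  {f | (∀ g, ρ g f = f) ∧ ∃ d, 0 < d ∧ f.IsHomogeneous d}

/-- `g` acts as a reflection: `g • p - p` is divisible by a fixed linear form. -/
def ActsAsReflection (g : G) : Prop :=
  ∃ l : MvPolynomial σ k, l ≠ 0 ∧ l.IsHomogeneous 1 ∧ ∀ p, l ∣ ρ g p - p

theorem apply_mem_span_positiveInvariants (g : G) {p : MvPolynomial σ k}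
    (hp : p ∈ Ideal.span (positiveInvariants ρ)) : ρ g p ∈ Ideal.span (positiveInvariants ρ) := by
  have h := Ideal.mem_map_of_mem (ρ g) hp
  rw [Ideal.map_span] at h
  refine Ideal.span_mono ?_ h
  rintro _ ⟨f, hf, rfl⟩
  rwa [hf.1 g]

/-- The ideal is stable under the action, so the elements fixing `p` modulo it form a subgroup, and
the generating reflections suffice. -/
theorem forall_apply_sub_mem (hG : Subgroup.closure {g | ActsAsReflection ρ g} = ⊤)
    {p : MvPolynomial σ k}
    (h : ∀ s, ActsAsReflection ρ s → ρ s p - p ∈ Ideal.span (positiveInvariants ρ)) (g : G) :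
    ρ g p - p ∈ Ideal.span (positiveInvariants ρ) := by
  have hg : g ∈ Subgroup.closure {g | ActsAsReflection ρ g} := hG ▸ Subgroup.mem_top g
  induction hg using Subgroup.closure_induction with
  | mem s hs => exact h s hs
  | one => simp
  | mul a b _ _ ha hb =>
    have := add_mem (apply_mem_span_positiveInvariants ρ a hb) ha
    rwa [map_sub, ← AlgHom.mul_apply, ← map_mul, sub_add_sub_cancel] at this
  | inv a _ ha =>
    have := neg_mem (apply_mem_span_positiveInvariants ρ a⁻¹ ha)
    rwa [map_sub, ← AlgHom.mul_apply, ← map_mul, inv_mul_cancel, map_one, AlgHom.one_apply,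
      neg_sub] at this

/-- Chevalley's lemma on relations between invariants. -/
theorem mem_span_positiveInvariants_of_sum_eq_zero [CharZero k] [Fintype G]
    (hρ : ∀ g p d, IsHomogeneous p d → IsHomogeneous (ρ g p) d)
    (hG : Subgroup.closure {g | ActsAsReflection ρ g} = ⊤) {ι : Type*} [DecidableEq ι]
    {T : Finset ι} {f : ι → MvPolynomial σ k} (hf : ∀ i ∈ T, ∀ g, ρ g (f i) = f i) {i₀ : ι}
    (hi₀ : i₀ ∈ T) (hmin : f i₀ ∉ Ideal.span (f '' (T.erase i₀ : Finset ι))) (d : ℕ)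
    (p : ι → MvPolynomial σ k) (hp : (p i₀).IsHomogeneous d) (hsum : ∑ i ∈ T, p i * f i = 0) :
    p i₀ ∈ Ideal.span (positiveInvariants ρ) := by
  induction d generalizing p with
  | zero =>
    rw [← totalDegree_zero_iff_isHomogeneous, totalDegree_eq_zero_iff_eq_C] at hp
    generalize coeff 0 (p i₀) = c at hp
    by_cases hc : c = 0
    · rw [hp, hc, C_0]
      exact zero_mem _
    -- A nonzero constant coefficient could be inverted, putting `f i₀` in the ideal of the other `f
    -- i`.
    · refine absurd ?_ hmin
      rw [← Finset.add_sum_erase T _ hi₀] at hsum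
      have h1 : f i₀ = C (-c⁻¹) * ∑ i ∈ T.erase i₀, p i * f i := by
        rw [eq_neg_of_add_eq_zero_right hsum, hp, mul_neg, ← mul_assoc, ← C_mul,
          neg_mul, inv_mul_cancel₀ hc]
        simp
      rw [h1]
      exact Ideal.mul_mem_left _ _ (Ideal.sum_mem _ fun i hi =>
        Ideal.mul_mem_left _ _ (Ideal.subset_span ⟨i, hi, rfl⟩))
  | succ d ih =>
    have key : ∀ g, ρ g (p i₀) - p i₀ ∈ Ideal.span (positiveInvariants ρ) := by
      refine forall_apply_sub_mem ρ hG fun s ⟨l, hl0, hl, hdvd⟩ => ?_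
      -- Subtracting the relation from its translate by `s` and dividing by `l` gives the relation
      -- `∑ q i * f i = 0`, in which `q i₀` has degree one less. Only the coefficient at `i₀` needs
      -- to be homogeneous.
      choose q hq using fun i => hdvd (p i)
      rw [hq]
      refine Ideal.mul_mem_left _ _ (ih q (hl.of_mul_left hl0 ?_) ?_)
      · rw [← hq]
        exact (hρ s _ _ hp).sub hp
      · refine mul_left_cancel₀ hl0 ?_
        have h1 : ∑ i ∈ T, ρ s (p i) * f i = 0 := by
          rw [← map_zero (ρ s), ← hsum, map_sum]
          exact Finset.sum_congr rfl fun i hi => by rw [map_mul, hf i hi]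
        rw [mul_zero, Finset.mul_sum, ← sub_zero (0 : MvPolynomial σ k)]
        nth_rewrite 1 [← h1]
        rw [← hsum, ← Finset.sum_sub_distrib]
        exact Finset.sum_congr rfl fun i _ => by rw [← mul_assoc, ← hq, sub_mul]
    -- The average lies in the ideal as an invariant of positive degree, and it is congruent to `p
    -- i₀` by `key`.
    have h2 : reynolds ρ (p i₀) ∈ Ideal.span (positiveInvariants ρ) :=
      Ideal.subset_span ⟨fun g => apply_reynolds ρ g _, d + 1, d.succ_pos,
        isHomogeneous_reynolds ρ hρ hp⟩
    simpa using sub_mem h2 (reynolds_sub_mem ρ key)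

end Invariants

end MvPolynomial

namespace MvPolynomial

/-! ### Chevalley's theorem. -/

section Chevalley

variable {σ k G : Type*} [Field k] [Group G]
  (ρ : G →* (MvPolynomial σ k →ₐ[k] MvPolynomial σ k))

/-- By noetherianity finitely many of the invariants themselves generate the ideal; an
inclusion-minimal such set has no redundant member. -/
theorem exists_minimal_positiveInvariants [Finite σ] [DecidableEq (MvPolynomial σ k)] :
    ∃ s : Finset (MvPolynomial σ k), (s : Set (MvPolynomial σ k)) ⊆ positiveInvariants ρ ∧
      Ideal.span (s : Set (MvPolynomial σ k)) = Ideal.span (positiveInvariants ρ) ∧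
      ∀ f ∈ s, f ∉ Ideal.span (s.erase f : Set (MvPolynomial σ k)) := by
  obtain ⟨s₀, hs₀, h₀⟩ := (Submodule.fg_span_iff_fg_span_finset_subset (positiveInvariants ρ)).1
    (IsNoetherian.noetherian (Ideal.span (positiveInvariants ρ)))
  obtain ⟨s, ⟨hs, hspan⟩, hmin⟩ := exists_minimal_of_wellFoundedLT
    (fun s : Finset (MvPolynomial σ k) => (s : Set (MvPolynomial σ k)) ⊆ positiveInvariants ρ ∧
      Ideal.span (s : Set (MvPolynomial σ k)) = Ideal.span (positiveInvariants ρ))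
    ⟨s₀, hs₀, h₀.symm⟩
  refine ⟨s, hs, hspan, fun f hf hmem => ?_⟩
  have hle := hmin (y := s.erase f) ⟨fun x hx => hs (Finset.mem_of_mem_erase hx), ?_⟩
    (Finset.erase_subset f s)
  · exact Finset.notMem_erase f s (hle hf)
  · refine le_antisymm (hspan ▸ Ideal.span_mono (Finset.erase_subset f s)) ?_
    rw [← hspan, Ideal.span_le]
    intro x hx
    by_cases hxf : x = f
    · exact hxf ▸ hmem
    · exact Ideal.subset_span (Finset.mem_erase.2 ⟨hxf, hx⟩)

/-- Hilbert's argument: a homogeneous invariant of positive degree is a combination of elements of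
`s`; averaging makes the coefficients invariant, and as their degree is smaller, induction applies
to them. -/
theorem mem_adjoin_of_invariant [CharZero k] [Fintype G]
    (hρ : ∀ g p d, IsHomogeneous p d → IsHomogeneous (ρ g p) d)
    {s : Finset (MvPolynomial σ k)} (hs : (s : Set (MvPolynomial σ k)) ⊆ positiveInvariants ρ)
    (hspan : Ideal.span (s : Set (MvPolynomial σ k)) = Ideal.span (positiveInvariants ρ))
    {p : MvPolynomial σ k} (hp : ∀ g, ρ g p = p) :
    p ∈ Algebra.adjoin k (s : Set (MvPolynomial σ k)) := by
  have key : ∀ d (p : MvPolynomial σ k), p.IsHomogeneous d → (∀ g, ρ g p = p) →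
      p ∈ Algebra.adjoin k (s : Set (MvPolynomial σ k)) := by
    intro d
    induction d using Nat.strong_induction_on with
    | _ d ih =>
      intro p hd hp
      rcases Nat.eq_zero_or_pos d with rfl | hpos
      · rw [← totalDegree_zero_iff_isHomogeneous, totalDegree_eq_zero_iff_eq_C] at hd
        rw [hd]
        exact Subalgebra.algebraMap_mem _ _
      have hmem : p ∈ Ideal.span (s : Set (MvPolynomial σ k)) :=
        hspan ▸ Ideal.subset_span ⟨hp, d, hpos, hd⟩
      obtain ⟨a, -, ha⟩ := Submodule.mem_span_finset.1 hmem
      simp only [smul_eq_mul] at ha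
      have hdeg : ∀ f : MvPolynomial σ k, ∃ e, f ∈ s → 0 < e ∧ f.IsHomogeneous e := fun f => by
        by_cases hf : f ∈ s
        · obtain ⟨e, he⟩ := (hs hf).2
          exact ⟨e, fun _ => he⟩
        · exact ⟨0, fun h => absurd h hf⟩
      choose e he using hdeg
      obtain ⟨h, hph, hh⟩ := exists_homogeneous_coeff (G := id) (fun f hf => (he f hf).2) hd ha.symm
      rw [← reynolds_eq_self ρ hp, hph, map_sum]
      refine Subalgebra.sum_mem _ fun f hf => ?_
      rw [id_eq, reynolds_mul ρ _ (hs hf).1]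
      refine Subalgebra.mul_mem _ ?_ (Algebra.subset_adjoin hf)
      rcases hh f with h0 | ⟨hle, hhom⟩
      · rw [h0, map_zero]
        exact Subalgebra.zero_mem _
      · exact ih _ (Nat.sub_lt hpos (he f hf).1) _ (isHomogeneous_reynolds ρ hρ hhom)
          fun g => apply_reynolds ρ g _
  rw [← sum_homogeneousComponent p]
  refine Subalgebra.sum_mem _ fun d hd => key d _ (homogeneousComponent_isHomogeneous d p) fun g => ?_
  -- The action preserves degrees, so it commutes with taking components, and the components of an
  -- invariant are invariant.
  have h1 : homogeneousComponent d (ρ g p) = ρ g (homogeneousComponent d p) := by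
    conv_lhs => rw [← sum_homogeneousComponent p, map_sum, map_sum]
    rw [Finset.sum_congr rfl fun i _ => homogeneousComponent_of_mem
      (hρ g _ i (homogeneousComponent_isHomogeneous i p)), Finset.sum_ite_eq, if_pos hd]
  rw [← h1, hp g]

/-- If there is an algebraic relation between homogeneous polynomials of positive degree, then there
is a weighted homogeneous one, nonzero, whose nonzero partial derivatives are not relations. -/
theorem exists_weightedHomogeneous_relation {τ : Type*} {f : τ → MvPolynomial σ k} {e : τ → ℕ}
    (hpos : ∀ i, 0 < e i) (hf : ∀ i, (f i).IsHomogeneous (e i)) (h : ¬ AlgebraicIndependent k f) :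
    ∃ (D : ℕ) (H : MvPolynomial τ k), H ≠ 0 ∧ H.IsWeightedHomogeneous e D ∧ aeval f H = 0 ∧
      ∀ i, pderiv i H = 0 ∨ e i ≤ D ∧ aeval f (pderiv i H) ≠ 0 ∧
        (aeval f (pderiv i H)).IsHomogeneous (D - e i) := by
  classical
  have hex : ∃ D, ∃ H : MvPolynomial τ k, H ≠ 0 ∧ H.IsWeightedHomogeneous e D ∧ aeval f H = 0 := by
    rw [algebraicIndependent_iff] at h
    push Not at h
    obtain ⟨H, hH, hH0⟩ := h
    have hD : ∃ D, weightedHomogeneousComponent e D H ≠ 0 := by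
      by_contra! hcon
      exact hH0 (by rw [← finsum_weightedHomogeneousComponent (w := e) (φ := H)]; simp [hcon])
    obtain ⟨D, hD⟩ := hD
    refine ⟨D, _, hD, weightedHomogeneousComponent_isWeightedHomogeneous D H, ?_⟩
    have hfin := weightedHomogeneousComponent_finsupp (w := e) H
    have h1 : ∑ i ∈ hfin.toFinset, weightedHomogeneousComponent e i H = H := by
      rw [← finsum_eq_sum _ hfin]
      exact finsum_weightedHomogeneousComponent e H
    -- With weights `e i = deg f i`, substitution turns weight into degree, so each weighted
    -- component of a relation is again a relation.
    have h2 : homogeneousComponent D (aeval f H) = aeval f (weightedHomogeneousComponent e D H) := by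
      conv_lhs => rw [← h1, map_sum, map_sum]
      rw [Finset.sum_congr rfl fun i _ => homogeneousComponent_of_mem
        (IsWeightedHomogeneous.aeval_isHomogeneous hf
          (weightedHomogeneousComponent_isWeightedHomogeneous i H)), Finset.sum_ite_eq, if_pos]
      exact hfin.mem_toFinset.2 hD
    rw [← h2, hH, map_zero]
  -- The weight is the least possible. A nonzero derivative has weight `D - e i < D`, so it cannot
  -- be a relation.
  obtain ⟨H, hH0, hH, hrel⟩ := Nat.find_spec hex
  refine ⟨Nat.find hex, H, hH0, hH, hrel, fun i => ?_⟩
  by_cases hle : e i ≤ Nat.find hex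
  · have hw := IsWeightedHomogeneous.pderiv (i := i) hH (Nat.sub_add_cancel hle)
    by_cases h0 : pderiv i H = 0
    · exact Or.inl h0
    · refine Or.inr ⟨hle, fun hz => ?_, IsWeightedHomogeneous.aeval_isHomogeneous hf hw⟩
      have := hpos i
      exact Nat.find_min hex (m := Nat.find hex - e i) (by omega) ⟨_, h0, hw, hz⟩
  · left
    ext m
    rw [coeff_pderiv, coeff_zero, hH.coeff_eq_zero, zero_mul]
    rw [map_add, Finsupp.weight_single, one_smul]
    omega

/-- Let `H` be a relation of least weight, and let the `F (∂_i H)`, `i ∈ T`, minimally generate the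
ideal of all the `F (∂_j H)`. Differentiating `F H = 0` gives relations between these invariants,
and Chevalley's lemma puts their coefficients in the ideal spanned by `s`. Euler's identity turns
this into an expression of one member of `s` through the others, contradicting minimality. -/
theorem algebraicIndependent_of_minimal [CharZero k] [Fintype G] [Fintype σ]
    [DecidableEq (MvPolynomial σ k)]
    (hρ : ∀ g p d, IsHomogeneous p d → IsHomogeneous (ρ g p) d)
    (hG : Subgroup.closure {g | ActsAsReflection ρ g} = ⊤)
    {s : Finset (MvPolynomial σ k)} (hs : (s : Set (MvPolynomial σ k)) ⊆ positiveInvariants ρ)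
    (hspan : Ideal.span (s : Set (MvPolynomial σ k)) = Ideal.span (positiveInvariants ρ))
    (hmin : ∀ f ∈ s, f ∉ Ideal.span (s.erase f : Set (MvPolynomial σ k))) :
    AlgebraicIndependent k ((↑) : s → MvPolynomial σ k) := by
  classical
  by_contra hcon
  choose e hpos he using fun f : s => (hs f.2).2
  obtain ⟨D, H, hH0, hH, hrel, hder⟩ := exists_weightedHomogeneous_relation hpos he hcon
  set F : MvPolynomial s k →ₐ[k] MvPolynomial σ k := aeval ((↑) : s → MvPolynomial σ k) with hF
  -- the derivatives do not all vanish
  have hne : ∃ i, pderiv i H ≠ 0 := by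
    by_contra! hz
    -- If all derivatives vanish, the weighted Euler identity gives `D • H = 0`, so `D = 0`. As the
    -- weights are positive, `H` is then a constant, and a relation that is constant is zero.
    have hEul := hH.sum_weight_X_mul_pderiv
    simp only [hz, mul_zero, smul_zero, Finset.sum_const_zero] at hEul
    obtain rfl : D = 0 := by
      rw [eq_comm, ← Nat.cast_smul_eq_nsmul k, smul_eq_zero] at hEul
      simpa [hH0] using hEul
    have h1 : weightedHomogeneousComponent e 0 H = H := weightedHomogeneousComponent_eq_self hH
    rw [weightedHomogeneousComponent_zero H fun i => (hpos i).ne'] at h1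
    rw [← h1, hF, aeval_C, algebraMap_eq, C_eq_zero] at hrel
    rw [hrel, C_0] at h1
    exact hH0 h1.symm
  -- a minimal set of derivatives generating the ideal of all derivatives
  obtain ⟨T, hT, hTmin⟩ := exists_minimal_of_wellFoundedLT
    (fun T : Finset s => Set.range (fun i => F (pderiv i H)) ⊆
      Ideal.span ((fun i => F (pderiv i H)) '' (T : Set s)))
    ⟨Finset.univ, by simp⟩
  have hTmin' : ∀ i ∈ T, F (pderiv i H) ∉
      Ideal.span ((fun i => F (pderiv i H)) '' (T.erase i : Finset s)) := by
    intro i hi hmem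
    have hle := hTmin (y := T.erase i) ?_ (Finset.erase_subset i T)
    · exact Finset.notMem_erase i T (hle hi)
    · refine hT.trans ?_
      change Ideal.span _ ≤ Ideal.span _
      rw [Ideal.span_le]
      rintro _ ⟨j, hj, rfl⟩
      by_cases hji : j = i
      · exact hji ▸ hmem
      · exact Ideal.subset_span ⟨j, Finset.mem_erase.2 ⟨hji, hj⟩, rfl⟩
  obtain ⟨i₀, hi₀⟩ : T.Nonempty := by
    rw [Finset.nonempty_iff_ne_empty]
    rintro rfl
    obtain ⟨i, hi⟩ := hne
    have := hT ⟨i, rfl⟩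
    simp only [Finset.coe_empty, Set.image_empty, Ideal.span_empty, SetLike.mem_coe,
      Ideal.mem_bot] at this
    exact ((hder i).resolve_left hi).2.1 this
  have hnz : ∀ i ∈ T, pderiv i H ≠ 0 := fun i hi h0 => hTmin' i hi (by simp [h0])
  -- the other derivatives in terms of these
  have hcoef : ∀ j, ∃ h : s → MvPolynomial σ k,
      F (pderiv j H) = ∑ i ∈ T, h i * F (pderiv i H) ∧
      ∀ i, h i = 0 ∨ (e j ≤ D ∧ D - e i ≤ D - e j ∧ (h i).IsHomogeneous (D - e j - (D - e i))) := by
    intro j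
    by_cases h0 : pderiv j H = 0
    · exact ⟨0, by simp [h0], fun i => Or.inl rfl⟩
    have hmem := hT ⟨j, rfl⟩
    obtain ⟨a, ha⟩ := (Submodule.mem_span_image_finset_iff_exists_fun _).1 hmem
    obtain ⟨hle, -, hhom⟩ := (hder j).resolve_left h0
    obtain ⟨h, h1, h2⟩ := exists_homogeneous_coeff (T := T) (G := fun i => F (pderiv i H))
      (e := fun i => D - e i) (fun i hi => ((hder i).resolve_left (hnz i hi)).2.2) hhom
      (a := fun i => if hi : i ∈ T then a ⟨i, hi⟩ else 0) (by
        refine ha.symm.trans ?_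
        rw [← Finset.sum_coe_sort T]
        simp)
    exact ⟨h, h1, fun i => (h2 i).imp_right fun h => ⟨hle, h⟩⟩
  choose h hh hhom using hcoef
  have hle₀ : e i₀ ≤ D := ((hder i₀).resolve_left (hnz i₀ hi₀)).1
  -- apply Chevalley's lemma
  have hp : ∀ t, pderiv t (i₀ : MvPolynomial σ k) + ∑ j ∈ Tᶜ, h j i₀ * pderiv t (j : MvPolynomial σ k)
      ∈ Ideal.span (s : Set (MvPolynomial σ k)) := by
    intro t
    rw [hspan]
    refine mem_span_positiveInvariants_of_sum_eq_zero ρ hρ hG (T := T)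
      (f := fun i => F (pderiv i H)) ?_ hi₀ (hTmin' i₀ hi₀) (e i₀ - 1)
      (fun i => pderiv t (i : MvPolynomial σ k) +
        ∑ j ∈ Tᶜ, h j i * pderiv t (j : MvPolynomial σ k)) ?_ ?_
    · intro i _ g
      change ((ρ g).comp F) _ = F _
      congr 1
      refine algHom_ext fun j => ?_
      simp only [hF, AlgHom.comp_apply, aeval_X]
      exact (hs j.2).1 g
    · refine (he i₀).pderiv.add (IsHomogeneous.sum _ _ _ fun j _ => ?_)
      rcases hhom j i₀ with h0 | ⟨h1, h2, h3⟩
      · rw [h0, zero_mul]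
        exact isHomogeneous_zero _ _ _
      · have := h3.mul ((he j).pderiv (i := t))
        -- No truncation occurs: `e j ≤ e i₀ ≤ D`, so the coefficient has degree `e i₀ - e j`, and
        -- `e j ≥ 1`.
        have hj := hpos j
        rwa [show D - e j - (D - e i₀) + (e j - 1) = e i₀ - 1 by omega] at this
    -- Chain rule for `F H = 0`; the terms with `j ∉ T` are rewritten through `h j` and collected at
    -- each `i ∈ T`.
    · have hd := pderiv_aeval ((↑) : s → MvPolynomial σ k) t H
      rw [hrel, map_zero, ← Finset.sum_add_sum_compl T] at hd
      rw [hd]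
      simp only [add_mul, Finset.sum_add_distrib, Finset.sum_mul]
      congr 1
      · exact Finset.sum_congr rfl fun i _ => mul_comm _ _
      · rw [Finset.sum_comm]
        refine Finset.sum_congr rfl fun j _ => ?_
        rw [hh j, Finset.sum_mul]
        exact Finset.sum_congr rfl fun i _ => by ring
  -- Euler's identity
  choose c hc using fun t => (Submodule.mem_span_range_iff_exists_fun _).1
    (show _ ∈ Submodule.span _ (Set.range ((↑) : s → MvPolynomial σ k)) by
      rw [Subtype.range_coe]; exact hp t)
  simp only [smul_eq_mul] at hc
  have hEul : (e i₀ : MvPolynomial σ k) * (i₀ : MvPolynomial σ k) = (∑ l : s, (∑ t, X t * c t l) * (l : MvPolynomial σ k)) -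
      ∑ j ∈ Tᶜ, (h j i₀ * e j) * (j : MvPolynomial σ k) := by
    rw [eq_sub_iff_add_eq]
    have h1 : ∀ i : s, (e i : MvPolynomial σ k) * i = ∑ t, X t * pderiv t (i : MvPolynomial σ k) :=
      fun i => by rw [(he i).sum_X_mul_pderiv, nsmul_eq_mul]
    simp only [mul_assoc, h1]
    simp only [Finset.sum_mul, mul_assoc]
    rw [Finset.sum_comm (s := Finset.univ (α := s))]
    simp only [← Finset.mul_sum, hc, mul_add, Finset.sum_add_distrib]
    congr 1
    simp only [Finset.mul_sum]
    rw [Finset.sum_comm]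
    exact Finset.sum_congr rfl fun t _ => Finset.sum_congr rfl fun j _ => by ring
  refine hmin i₀ i₀.2 ?_
  -- Compare components of degree `e i₀` in `hEul`. The coefficient `∑ t, X t * c t i₀` of `i₀` has
  -- no constant term, so `i₀` drops out on the right and only other generators remain.
  have hcomp : ∀ (a : MvPolynomial σ k) (l : s), l ≠ i₀ →
      homogeneousComponent (e i₀) (a * (l : MvPolynomial σ k)) ∈ Ideal.span (s.erase (i₀ : MvPolynomial σ k) : Set (MvPolynomial σ k)) := by
    intro a l hl
    rw [homogeneousComponent_mul_of_isHomogeneous (he l)]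
    split_ifs
    · exact Ideal.mul_mem_left _ _ (Ideal.subset_span
        (Finset.mem_coe.2 (Finset.mem_erase.2 ⟨fun h => hl (Subtype.ext h), l.2⟩)))
    · exact zero_mem _
  have hmem : (e i₀ : MvPolynomial σ k) * (i₀ : MvPolynomial σ k) ∈
      Ideal.span (s.erase (i₀ : MvPolynomial σ k) : Set (MvPolynomial σ k)) := by
    have h1 : homogeneousComponent (e i₀) ((e i₀ : MvPolynomial σ k) * (i₀ : MvPolynomial σ k)) =
        (e i₀ : MvPolynomial σ k) * (i₀ : MvPolynomial σ k) := by
      rw [homogeneousComponent_mul_of_isHomogeneous (he i₀), if_pos le_rfl, Nat.sub_self,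
        homogeneousComponent_zero]
      congr 1
      rw [← map_natCast C, coeff_C, if_pos rfl]
    rw [← h1, hEul, map_sub, map_sum, map_sum]
    refine sub_mem (Ideal.sum_mem _ fun l _ => ?_) (Ideal.sum_mem _ fun j hj => hcomp _ _ ?_)
    · by_cases hl : l = i₀
      · rw [hl, homogeneousComponent_mul_of_isHomogeneous (he i₀), if_pos le_rfl, Nat.sub_self,
          homogeneousComponent_zero]
        have h0 : coeff 0 (∑ t, X t * c t i₀) = 0 := by
          rw [coeff_sum]
          exact Finset.sum_eq_zero fun t _ => by rw [coeff_X_mul', if_neg (by simp)]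
        rw [h0, C_0, zero_mul]
        exact zero_mem _
      · exact hcomp _ _ hl
    · rintro rfl
      exact Finset.mem_compl.1 hj hi₀
  have hC : (i₀ : MvPolynomial σ k) = C ((e i₀ : k)⁻¹) * ((e i₀ : MvPolynomial σ k) * (i₀ : MvPolynomial σ k)) := by
    rw [← mul_assoc, ← map_natCast C, ← C_mul, inv_mul_cancel₀ (by exact_mod_cast (hpos i₀).ne'),
      C_1, one_mul]
  have hmem' := Ideal.mul_mem_left _ (C ((e i₀ : k)⁻¹)) hmem
  rwa [← hC] at hmem'

/-- **Chevalley's theorem**: a finite group acting linearly on a polynomial ring over a field of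
characteristic zero, and generated by reflections, has a polynomial ring of invariants. -/
theorem exists_algebraicIndependent_adjoin_eq_invariants [CharZero k] [Finite G] {n : ℕ}
    (ρ : G →* (MvPolynomial (Fin n) k →ₐ[k] MvPolynomial (Fin n) k))
    (hρ : ∀ g p d, IsHomogeneous p d → IsHomogeneous (ρ g p) d)
    (hG : Subgroup.closure {g | ActsAsReflection ρ g} = ⊤) :
    ∃ f : Fin n → MvPolynomial (Fin n) k, AlgebraicIndependent k f ∧
      ∀ p, p ∈ Algebra.adjoin k (Set.range f) ↔ ∀ g, ρ g p = p := by
  classical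
  cases nonempty_fintype G
  obtain ⟨s, hs, hspan, hmin⟩ := exists_minimal_positiveInvariants ρ
  have hind := algebraicIndependent_of_minimal ρ hρ hG hs hspan hmin
  have hmem : ∀ p, p ∈ Algebra.adjoin k (s : Set (MvPolynomial (Fin n) k)) ↔ ∀ g, ρ g p = p := by
    refine fun p => ⟨fun hp g => ?_, mem_adjoin_of_invariant ρ hρ hs hspan⟩
    have hle : Algebra.adjoin k (s : Set (MvPolynomial (Fin n) k)) ≤
        AlgHom.equalizer (ρ g) (AlgHom.id k _) := Algebra.adjoin_le fun f hf => (hs hf).1 g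
    exact hle hp
  -- The polynomial ring is integral over the invariants of a finite group. Hence `s` is a
  -- transcendence basis, and it has as many elements as there are variables.
  have halg : Algebra.IsAlgebraic
      (Algebra.adjoin k (Set.range ((↑) : s → MvPolynomial (Fin n) k))) (MvPolynomial (Fin n) k) := by
    have hmem' : ∀ p, p ∈ Algebra.adjoin k (Set.range ((↑) : s → MvPolynomial (Fin n) k)) ↔
        ∀ g, ρ g p = p := fun p => by rw [← hmem p, Subtype.range_coe]
    let : MulSemiringAction G (MvPolynomial (Fin n) k) :=
      { smul := fun g p => ρ g p
        one_smul := fun p => by change ρ 1 p = p; rw [map_one, AlgHom.one_apply]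
        mul_smul := fun g h p => by
          change ρ (g * h) p = ρ g (ρ h p); rw [map_mul, AlgHom.mul_apply]
        smul_zero := fun g => map_zero (ρ g)
        smul_add := fun g => map_add (ρ g)
        smul_one := fun g => map_one (ρ g)
        smul_mul := fun g => map_mul (ρ g) }
    have : Algebra.IsInvariant (Algebra.adjoin k (Set.range ((↑) : s → MvPolynomial (Fin n) k)))
        (MvPolynomial (Fin n) k) G := ⟨fun p hp => ⟨⟨p, (hmem' p).2 hp⟩, rfl⟩⟩
    have := Algebra.IsInvariant.isIntegral
      (Algebra.adjoin k (Set.range ((↑) : s → MvPolynomial (Fin n) k))) (MvPolynomial (Fin n) k) G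
    exact Algebra.IsIntegral.isAlgebraic
  have hX : IsTranscendenceBasis k (X : Fin n → MvPolynomial (Fin n) k) :=
    IsTranscendenceBasis.mvPolynomial (Fin n) k
  have hcard := (hind.isTranscendenceBasis_iff_isAlgebraic.2 halg).lift_cardinalMk_eq hX
  have e : Fin n ≃ s := by
    have h1 : s.card = n := by simpa using hcard
    exact (Fin.castOrderIso h1.symm).toEquiv.trans s.equivFin.symm
  refine ⟨fun i => e i, hind.comp e e.injective, fun p => ?_⟩
  rw [← hmem p]
  have h2 : Set.range (fun i => (e i : MvPolynomial (Fin n) k)) = s := by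
    change Set.range (Subtype.val ∘ e) = s
    rw [e.surjective.range_comp, Subtype.range_coe]
  rw [h2]

end Chevalley

end MvPolynomial

/-! ### Quotients of manifolds by free, properly discontinuous actions. -/

namespace MulAction

open scoped Topology
open Set Filter

section LocalInverse

variable {M : Type*} [TopologicalSpace M] {G : Type*} [Group G] [MulAction G M]
  [ContinuousConstSMul G M]

/-- A local inverse of the quotient map, composed with the quotient map, is locally given by the
action of a group element. -/
theorem exists_localInverseAt_comp_mk_eventuallyEq_smul
    (hmk : IsLocalHomeomorph (Quotient.mk (orbitRel G M))) (x y : M)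
    (hy : Quotient.mk (orbitRel G M) y ∈ (hmk.localInverseAt x).source) :
    ∃ g : G, g • y ∈ (hmk.localInverseAt x).target ∧
      (fun z => hmk.localInverseAt x (Quotient.mk (orbitRel G M) z)) =ᶠ[𝓝 y] fun z => g • z := by
  set e := hmk.localInverseAt x with he
  have hsymm : ∀ z, e.symm z = Quotient.mk (orbitRel G M) z := fun z => by
    rw [he, hmk.localInverseAt_symm]
  obtain ⟨g, hg⟩ : ∃ g : G, g • y = e (Quotient.mk (orbitRel G M) y) := by
    have h1 := e.left_inv hy
    rw [hsymm] at h1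
    exact Quotient.exact h1
  have hmem : g • y ∈ e.target := hg ▸ e.map_source hy
  refine ⟨g, hmem, ?_⟩
  filter_upwards [(continuous_const_smul g).continuousAt.preimage_mem_nhds
    (e.open_target.mem_nhds hmem)] with z hz
  have h2 : Quotient.mk (orbitRel G M) z = Quotient.mk (orbitRel G M) (g • z) :=
    (Quotient.sound ⟨g, rfl⟩ : Quotient.mk (orbitRel G M) (g • z) = _).symm
  change e (Quotient.mk (orbitRel G M) z) = g • z
  rw [h2, ← hsymm]
  exact e.right_inv hz

end LocalInverse

section Manifold

variable {𝕜 : Type*} [NontriviallyNormedField 𝕜] {E : Type*} [NormedAddCommGroup E]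
  [NormedSpace 𝕜 E] {H : Type*} [TopologicalSpace H] {I : ModelWithCorners 𝕜 E H} {n : WithTop ℕ∞}
  {M : Type*} [TopologicalSpace M] [ChartedSpace H M] {G : Type*} [Group G] [MulAction G M]
  [ProperlyDiscontinuousSMul G M] [ContinuousConstSMul G M] [IsCancelSMul G M]
  [T2Space M] [LocallyCompactSpace M]

theorem isLocalHomeomorph_quotientMk : IsLocalHomeomorph (Quotient.mk (orbitRel G M)) :=
  isQuotientCoveringMap_quotientMk_of_properlyDiscontinuousSMul.isCoveringMap.isLocalHomeomorph

theorem exists_chartAt_quotient_eq (q : orbitRel.Quotient G M) :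
    ∃ x : M, Quotient.mk (orbitRel G M) x = q ∧ chartAt H q =
      (isLocalHomeomorph_quotientMk.localInverseAt x).trans (chartAt H x) :=
  ⟨_, (Quotient.mk_surjective (s := orbitRel G M)).hasRightInverse.choose_spec q, rfl⟩

theorem exists_eq_of_mem_atlas_quotient {e : OpenPartialHomeomorph (orbitRel.Quotient G M) H}
    (he : e ∈ atlas H (orbitRel.Quotient G M)) :
    ∃ x : M, e = (isLocalHomeomorph_quotientMk.localInverseAt x).trans (chartAt H x) := by
  obtain ⟨q, rfl⟩ := he
  exact ⟨_, rfl⟩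

variable {E' : Type*} [NormedAddCommGroup E'] [NormedSpace 𝕜 E'] {H' : Type*} [TopologicalSpace H']
  {J : ModelWithCorners 𝕜 E' H'} {N : Type*} [TopologicalSpace N] [ChartedSpace H' N]
  {E'' : Type*} [NormedAddCommGroup E''] [NormedSpace 𝕜 E''] {H'' : Type*} [TopologicalSpace H'']
  {K : ModelWithCorners 𝕜 E'' H''} {P : Type*} [TopologicalSpace P] [ChartedSpace H'' P]

variable [IsManifold I n M]

/-- Near `y` the local inverse after the quotient map is translation by some `g`, so the map is a
chart of `M` composed with `g • ·`. -/
theorem contMDiffAt_extChartAt_localInverseAt_comp_mk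
    (hG : ∀ g : G, ContMDiff I I n fun x : M => g • x) {x y : M}
    (hy : Quotient.mk (orbitRel G M) y ∈
      ((isLocalHomeomorph_quotientMk.localInverseAt x).trans (chartAt H x)).source) :
    ContMDiffAt I 𝓘(𝕜, E) n (fun z => I ((isLocalHomeomorph_quotientMk.localInverseAt x).trans
      (chartAt H x) (Quotient.mk (orbitRel G M) z))) y := by
  rw [OpenPartialHomeomorph.trans_source] at hy
  obtain ⟨g, -, heq⟩ := exists_localInverseAt_comp_mk_eventuallyEq_smul
    isLocalHomeomorph_quotientMk x y hy.1
  have h1 : ContMDiffAt I 𝓘(𝕜, E) n (extChartAt I x ∘ fun z => g • z) y := by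
    refine ContMDiffAt.comp y (contMDiffAt_extChartAt' ?_) (hG g y)
    have h2 := heq.self_of_nhds
    beta_reduce at h2
    rw [← h2]
    exact hy.2
  refine h1.congr_of_eventuallyEq ?_
  filter_upwards [heq] with z hz
  simp [← hz]

/-- The quotient of a `C^n` manifold by a free, properly discontinuous action by `C^n` maps is a
`C^n` manifold. -/
theorem isManifold_quotient (hG : ∀ g : G, ContMDiff I I n fun x : M => g • x) :
    IsManifold I n (orbitRel.Quotient G M) := by
  refine isManifold_of_contDiffOn I n _ fun e e' he he' => ?_
  obtain ⟨x, rfl⟩ := exists_eq_of_mem_atlas_quotient he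
  obtain ⟨x', rfl⟩ := exists_eq_of_mem_atlas_quotient he'
  rw [← contMDiffOn_iff_contDiffOn]
  rintro _ ⟨hu, h, rfl⟩
  rw [mem_preimage, I.left_inv] at hu
  have h1 : h ∈ (chartAt H x).target := hu.1.1
  -- The transition map is the second chart after the quotient map, read in the chart of `M` at `x`.
  have h2 : Quotient.mk (orbitRel G M) ((chartAt H x).symm h) ∈
      ((isLocalHomeomorph_quotientMk.localInverseAt x').trans (chartAt H x')).source := by
    simpa using hu.2
  have h3 := (contMDiffAt_iff_source_of_mem_source ((chartAt H x).map_target h1)).1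
    (contMDiffAt_extChartAt_localInverseAt_comp_mk hG h2)
  simp only [extChartAt_coe, Function.comp_apply, (chartAt H x).right_inv h1] at h3
  refine (h3.congr (fun z _ => ?_) ?_).mono inter_subset_right
  · simp
  · simp

theorem contMDiff_quotientMk (hG : ∀ g : G, ContMDiff I I n fun x : M => g • x) :
    ContMDiff I I n (Quotient.mk (orbitRel G M)) := by
  intro y
  rw [contMDiffAt_iff_target]
  refine ⟨isLocalHomeomorph_quotientMk.continuous.continuousAt, ?_⟩
  obtain ⟨x, hx, hchart⟩ := exists_chartAt_quotient_eq (H := H) (Quotient.mk (orbitRel G M) y)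
  have hmem := mem_chart_source H (Quotient.mk (orbitRel G M) y)
  rw [hchart] at hmem
  refine (contMDiffAt_extChartAt_localInverseAt_comp_mk hG hmem).congr_of_eventuallyEq
    (Eventually.of_forall fun z => ?_)
  simp [extChartAt, hchart]

/-- A map on the quotient is `C^n` if its composition with the quotient map is. -/
theorem contMDiffAt_of_comp_quotientMk (hG : ∀ g : G, ContMDiff I I n fun x : M => g • x)
    {F : orbitRel.Quotient G M → N} {x : M}
    (hF : ContMDiffAt I J n (fun z => F (Quotient.mk (orbitRel G M) z)) x) :
    ContMDiffAt I J n F (Quotient.mk (orbitRel G M) x) := by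
  obtain ⟨x', hx', hchart⟩ := exists_chartAt_quotient_eq (H := H) (Quotient.mk (orbitRel G M) x)
  have hmem := mem_chart_source H (Quotient.mk (orbitRel G M) x)
  rw [hchart, OpenPartialHomeomorph.trans_source] at hmem
  obtain ⟨g, -, heq⟩ := exists_localInverseAt_comp_mk_eventuallyEq_smul
    isLocalHomeomorph_quotientMk x' x hmem.1
  have hgx : isLocalHomeomorph_quotientMk.localInverseAt x' (Quotient.mk (orbitRel G M) x) = g • x :=
    heq.self_of_nhds
  -- The chart at the class of `x` comes from another representative `x'`, whose local inverse sends
  -- this class to `g • x`; the hypothesis is moved there by `g⁻¹`.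
  have hF' : ContMDiffAt I J n (fun z => F (Quotient.mk (orbitRel G M) z)) (g • x) := by
    have h1 : ContMDiffAt I J n ((fun z => F (Quotient.mk (orbitRel G M) z)) ∘ fun z => g⁻¹ • z)
        (g • x) := ContMDiffAt.comp (g • x) (by rwa [inv_smul_smul]) (hG g⁻¹ _)
    refine h1.congr_of_eventuallyEq (Eventually.of_forall fun z => ?_)
    exact congrArg F (Quotient.sound (⟨g, smul_inv_smul g z⟩ : orbitRel G M z (g⁻¹ • z)))
  have hsource : g • x ∈ (chartAt H x').source := by
    rw [← hgx]
    exact hmem.2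
  rw [contMDiffAt_iff_source_of_mem_source hsource] at hF'
  rw [contMDiffAt_iff_source]
  simpa [extChartAt, hchart, Function.comp_def, hgx] using hF'

/-- Only the first factor is a quotient, so `F` is written locally through a `C^n` section `e` of
the quotient map. This serves the inverse trivialization, defined on `Base W × V`. -/
theorem contMDiffAt_prod_of_comp_quotientMk (hG : ∀ g : G, ContMDiff I I n fun x : M => g • x)
    {F : orbitRel.Quotient G M × N → P} {x : M} {v : N}
    (hF : ContMDiffAt (I.prod J) K n
      (fun z : M × N => F (Quotient.mk (orbitRel G M) z.1, z.2)) (x, v)) :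
    ContMDiffAt (I.prod J) K n F (Quotient.mk (orbitRel G M) x, v) := by
  set e := (isLocalHomeomorph_quotientMk (G := G) (M := M)).localInverseAt x with he
  have hsymm : ∀ z, e.symm z = Quotient.mk (orbitRel G M) z := fun z => by
    rw [he, IsLocalHomeomorph.localInverseAt_symm]
  have hx : Quotient.mk (orbitRel G M) x ∈ e.source := by simp [he]
  have hex : e (Quotient.mk (orbitRel G M) x) = x := by simp [he]
  have hsec : ContMDiffAt I I n e (Quotient.mk (orbitRel G M) x) := by
    refine contMDiffAt_of_comp_quotientMk hG ?_
    obtain ⟨g, -, heq⟩ := exists_localInverseAt_comp_mk_eventuallyEq_smul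
      isLocalHomeomorph_quotientMk x x hx
    exact (hG g x).congr_of_eventuallyEq heq
  have h1 : ContMDiffAt (I.prod J) K n
      ((fun z : M × N => F (Quotient.mk (orbitRel G M) z.1, z.2)) ∘
        fun z : orbitRel.Quotient G M × N => (e z.1, z.2)) (Quotient.mk (orbitRel G M) x, v) := by
    refine ContMDiffAt.comp _ (by simpa [hex] using hF) ?_
    exact (ContMDiffAt.comp (Quotient.mk (orbitRel G M) x, v) hsec contMDiffAt_fst).prodMk
      contMDiffAt_snd
  refine h1.congr_of_eventuallyEq ?_
  filter_upwards [continuous_fst.continuousAt.preimage_mem_nhds (e.open_source.mem_nhds hx)]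
    with z hz
  have h2 : Quotient.mk (orbitRel G M) (e z.1) = z.1 := by
    rw [← hsymm, e.left_inv hz]
  simp [h2]

end Manifold

end MulAction

/-! ### Polynomial functions in coordinates, basic invariants, and hypersurfaces inside unions of
subspaces. -/

namespace ReflBundle

open MvPolynomial

section Coordinates

variable {V : Type*} [AddCommGroup V] [Module ℂ V] {n : ℕ} (b : Module.Basis (Fin n) ℂ V)

/-- The function on `V` defined by a polynomial in the coordinates with respect to `b`. -/
noncomputable def polyEval : MvPolynomial (Fin n) ℂ →ₐ[ℂ] (V → ℂ) :=
  aeval fun i v => b.repr v i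

theorem polyEval_apply (p : MvPolynomial (Fin n) ℂ) (v : V) :
    polyEval b p v = eval (b.repr v) p := by
  induction p using MvPolynomial.induction_on with
  | C a => simp [polyEval]
  | add p q hp hq => simp [hp, hq]
  | mul_X p i hp => rw [map_mul, Pi.mul_apply, hp]; simp [polyEval]

theorem repr_equivFun_symm (y : Fin n → ℂ) : ⇑(b.repr (b.equivFun.symm y)) = y :=
  b.equivFun.apply_symm_apply y

theorem polyEval_injective : Function.Injective (polyEval b) := by
  intro p q h
  refine MvPolynomial.funext fun y => ?_
  have := congrFun h (b.equivFun.symm y)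
  rwa [polyEval_apply, polyEval_apply, repr_equivFun_symm] at this

/-- The linear polynomial which represents a linear form. -/
noncomputable def linForm (φ : Module.Dual ℂ V) : MvPolynomial (Fin n) ℂ :=
  ∑ j, C (φ (b j)) * X j

theorem polyEval_linForm (φ : Module.Dual ℂ V) : polyEval b (linForm b φ) = φ := by
  ext v
  conv_rhs => rw [← b.sum_repr v, map_sum]
  simp [polyEval_apply, linForm, mul_comm]

theorem isHomogeneous_linForm (φ : Module.Dual ℂ V) : (linForm b φ).IsHomogeneous 1 :=
  IsHomogeneous.sum _ _ _ fun j _ => isHomogeneous_C_mul_X (φ (b j)) j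

theorem linForm_injective : Function.Injective (linForm b) := fun φ ψ h => by
  have := congrArg (polyEval b) h
  rw [polyEval_linForm, polyEval_linForm] at this
  exact DFunLike.coe_injective this

theorem range_polyEval : (polyEval b).range = polyFun V := by
  refine le_antisymm ?_ (Algebra.adjoin_le ?_)
  · rw [polyEval, ← Algebra.adjoin_range_eq_range_aeval]
    refine Algebra.adjoin_mono ?_
    rintro _ ⟨i, rfl⟩
    exact ⟨b.coord i, rfl⟩
  · rintro _ ⟨φ, rfl⟩
    exact ⟨linForm b φ, polyEval_linForm b φ⟩

/-- Substitution of a linear map into a polynomial. -/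
noncomputable def polyComp (A : V →ₗ[ℂ] V) : MvPolynomial (Fin n) ℂ →ₐ[ℂ] MvPolynomial (Fin n) ℂ :=
  aeval fun i => linForm b (b.coord i ∘ₗ A)

theorem polyEval_polyComp (A : V →ₗ[ℂ] V) (p : MvPolynomial (Fin n) ℂ) (v : V) :
    polyEval b (polyComp b A p) v = polyEval b p (A v) := by
  induction p using MvPolynomial.induction_on with
  | C a => simp [polyComp, polyEval_apply]
  | add p q hp hq => simp [hp, hq]
  | mul_X p i hp =>
    rw [map_mul, map_mul, map_mul, Pi.mul_apply, Pi.mul_apply, hp, polyComp, aeval_X,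
      polyEval_linForm]
    simp [polyEval_apply]

variable (W : Subgroup (LinearMap.GeneralLinearGroup ℂ V))

/-- The action of `W` on polynomials in the coordinates, `(w • p)(v) = p(w⁻¹ v)`. -/
noncomputable def polyAct : W →* (MvPolynomial (Fin n) ℂ →ₐ[ℂ] MvPolynomial (Fin n) ℂ) where
  toFun w := polyComp b ((w⁻¹ : W) : LinearMap.GeneralLinearGroup ℂ V).1
  map_one' := AlgHom.ext fun p => polyEval_injective b <| funext fun v => by
    rw [polyEval_polyComp, inv_one]
    rfl
  map_mul' w w' := AlgHom.ext fun p => polyEval_injective b <| funext fun v => by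
    rw [AlgHom.mul_apply, polyEval_polyComp, polyEval_polyComp, polyEval_polyComp, mul_inv_rev]
    rfl

theorem polyEval_polyAct (w : W) (p : MvPolynomial (Fin n) ℂ) (v : V) :
    polyEval b (polyAct b W w p) v = polyEval b p (w⁻¹ • v) :=
  polyEval_polyComp b _ p v

theorem isHomogeneous_polyAct (w : W) (p : MvPolynomial (Fin n) ℂ) (d : ℕ)
    (hp : p.IsHomogeneous d) : (polyAct b W w p).IsHomogeneous d := by
  have := hp.aeval _ fun i => isHomogeneous_linForm b (b.coord i ∘ₗ
    ((w⁻¹ : W) : LinearMap.GeneralLinearGroup ℂ V).1)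
  rwa [one_mul] at this

theorem mem_invariantAlgebra_iff (p : MvPolynomial (Fin n) ℂ) :
    polyEval b p ∈ invariantAlgebra W ↔ ∀ w, polyAct b W w p = p := by
  constructor
  · intro h w
    refine polyEval_injective b (funext fun v => ?_)
    rw [polyEval_polyAct]
    exact h.2 w⁻¹ v
  · refine fun h => ⟨range_polyEval b ▸ ⟨p, rfl⟩, fun w v => ?_⟩
    rw [← inv_inv w, ← polyEval_polyAct, h]

/-- A hyperplane is the kernel of a linear form, unique up to scalars. -/
theorem exists_dual_of_finrank_add_one [FiniteDimensional ℂ V] {U : Submodule ℂ V}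
    (hU : Module.finrank ℂ U + 1 = Module.finrank ℂ V) :
    ∃ φ : Module.Dual ℂ V, φ ≠ 0 ∧ ∀ ψ : Module.Dual ℂ V, (∀ u ∈ U, ψ u = 0) → ∃ c : ℂ, c • φ = ψ := by
  have h1 : Module.finrank ℂ U.dualAnnihilator = 1 := by
    have := Subspace.finrank_add_finrank_dualAnnihilator_eq U
    omega
  obtain ⟨φ, hφ, h⟩ := finrank_eq_one_iff'.1 h1
  refine ⟨φ, fun h0 => hφ (Subtype.ext h0), fun ψ hψ => ?_⟩
  obtain ⟨c, hc⟩ := h ⟨ψ, (Submodule.mem_dualAnnihilator ψ).2 hψ⟩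
  exact ⟨c, congrArg Subtype.val hc⟩

theorem linForm_smul (c : ℂ) (φ : Module.Dual ℂ V) : linForm b (c • φ) = C c * linForm b φ :=
  polyEval_injective b <| by
    rw [map_mul, polyEval_linForm, polyEval_linForm]
    ext v
    simp

theorem linForm_sub (φ ψ : Module.Dual ℂ V) : linForm b (φ - ψ) = linForm b φ - linForm b ψ :=
  polyEval_injective b <| by
    rw [map_sub, polyEval_linForm, polyEval_linForm, polyEval_linForm]
    rfl

theorem linForm_coord (i : Fin n) : linForm b (b.coord i) = X i :=
  polyEval_injective b <| by
    rw [polyEval_linForm]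
    ext v
    simp [polyEval_apply]

theorem linForm_ne_zero {φ : Module.Dual ℂ V} (h : φ ≠ 0) : linForm b φ ≠ 0 := fun h0 =>
  h (linForm_injective b (h0.trans (by simp [linForm])))

/-- Modulo the linear form of the fixed hyperplane, `w` acts trivially on the coordinates, since
`coord i ∘ w⁻¹ - coord i` vanishes on that hyperplane. Being an algebra map, it then acts trivially
on all polynomials. -/
theorem actsAsReflection_polyAct [FiniteDimensional ℂ V] {w : W}
    (hw : IsReflection (w : LinearMap.GeneralLinearGroup ℂ V)) :
    ActsAsReflection (polyAct b W) w := by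
  obtain ⟨φ, hφ, h⟩ := exists_dual_of_finrank_add_one hw.2
  refine ⟨linForm b φ, linForm_ne_zero b hφ, isHomogeneous_linForm b φ, fun p => ?_⟩
  rw [← Ideal.mem_span_singleton, ← Ideal.Quotient.eq]
  change ((Ideal.Quotient.mkₐ ℂ _).comp (polyAct b W w)) p = Ideal.Quotient.mkₐ ℂ _ p
  congr 1
  refine algHom_ext fun i => ?_
  change Ideal.Quotient.mk _ _ = Ideal.Quotient.mk _ _
  rw [Ideal.Quotient.eq, Ideal.mem_span_singleton]
  obtain ⟨c, hc⟩ := h (b.coord i ∘ₗ ((w⁻¹ : W) : LinearMap.GeneralLinearGroup ℂ V).1 - b.coord i)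
    fun u hu => by
      have hu' : w • u = u := (mem_fixedSpace _ _).1 hu
      have h1 : ((w⁻¹ : W) : LinearMap.GeneralLinearGroup ℂ V).1 u = u :=
        inv_smul_eq_iff.2 hu'.symm
      rw [LinearMap.sub_apply, LinearMap.comp_apply, h1, sub_self]
  have h2 : polyAct b W w (X i) =
      linForm b (b.coord i ∘ₗ ((w⁻¹ : W) : LinearMap.GeneralLinearGroup ℂ V).1) := by
    change polyComp b _ _ = _
    rw [polyComp, aeval_X]
  change linForm b φ ∣ polyAct b W w (X i) - X i
  rw [h2, ← linForm_coord b i, ← linForm_sub, ← hc, linForm_smul]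
  exact Dvd.intro_left _ rfl

theorem closure_actsAsReflection [FiniteDimensional ℂ V] (hW : IsReflectionGroup W) :
    Subgroup.closure {w : W | ActsAsReflection (polyAct b W) w} = ⊤ := by
  refine Subgroup.map_injective W.subtype_injective (le_antisymm (Subgroup.map_mono le_top) ?_)
  rw [MonoidHom.map_closure, ← MonoidHom.range_eq_map, Subgroup.range_subtype]
  conv_lhs => rw [← hW]
  exact Subgroup.closure_mono fun s hs => ⟨⟨s, hs.1⟩, actsAsReflection_polyAct b W hs.2, rfl⟩

theorem comp_mem_polyFun {g : V → ℂ} (hg : g ∈ polyFun V) (A : V →ₗ[ℂ] V) :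
    (fun v => g (A v)) ∈ polyFun V := by
  induction hg using Algebra.adjoin_induction with
  | mem g hg =>
    obtain ⟨φ, rfl⟩ := hg
    exact Algebra.subset_adjoin ⟨φ ∘ₗ A, rfl⟩
  | algebraMap c => exact Subalgebra.algebraMap_mem _ c
  | add g h _ _ hg hh => exact add_mem hg hh
  | mul g h _ _ hg hh => exact mul_mem hg hh

theorem mem_polyFun_of_isBasicInvariants {W : Subgroup (LinearMap.GeneralLinearGroup ℂ V)}
    {f : Fin n → V → ℂ} (hf : IsBasicInvariants W f)
    (i : Fin n) : f i ∈ polyFun V := by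
  have h : f i ∈ invariantAlgebra W := hf.2 ▸ Algebra.subset_adjoin ⟨i, rfl⟩
  exact h.1

/-- Chevalley's theorem: a finite reflection group has basic invariants. -/
theorem exists_isBasicInvariants [FiniteDimensional ℂ V] [Finite W]
    (b : Module.Basis (Fin n) ℂ V) (hW : IsReflectionGroup W) :
    ∃ f : Fin n → V → ℂ, IsBasicInvariants W f := by
  obtain ⟨f, hf, hmem⟩ := exists_algebraicIndependent_adjoin_eq_invariants (polyAct b W)
    (isHomogeneous_polyAct b W) (closure_actsAsReflection b W hW)
  refine ⟨fun i => polyEval b (f i), hf.map' (polyEval_injective b), ?_⟩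
  have h1 : Set.range (fun i => polyEval b (f i)) = polyEval b '' Set.range f :=
    Set.range_comp (polyEval b) f
  rw [h1, ← AlgHom.map_adjoin]
  ext g
  constructor
  · rintro ⟨p, hp, rfl⟩
    exact (mem_invariantAlgebra_iff b W p).2 ((hmem p).1 hp)
  · intro hg
    obtain ⟨p, rfl⟩ : g ∈ (polyEval b).range := range_polyEval b ▸ hg.1
    exact ⟨p, (hmem p).2 ((mem_invariantAlgebra_iff b W p).1 hg), rfl⟩

/-- If the zero set of a nonzero polynomial lies in a finite union of subspaces, then each of its
points lies in one of these subspaces of codimension at most one. -/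
theorem exists_finrank_le_of_zeros_subset [FiniteDimensional ℂ V] {J : MvPolynomial (Fin n) ℂ}
    (hJ : J ≠ 0) {x : V} (hx : polyEval b J x = 0) {ι : Type*} (s : Finset ι)
    (U : ι → Submodule ℂ V) (hU : ∀ v, polyEval b J v = 0 → ∃ i ∈ s, v ∈ U i) :
    ∃ i ∈ s, x ∈ U i ∧ Module.finrank ℂ V ≤ Module.finrank ℂ (U i) + 1 := by
  obtain ⟨P, hP, hPJ, hPx⟩ : ∃ P, Prime P ∧ P ∣ J ∧ polyEval b P x = 0 := by
    obtain ⟨m, hm, u, hu⟩ := UniqueFactorizationMonoid.exists_prime_factors J hJ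
    rw [polyEval_apply, ← hu, map_mul, mul_eq_zero, or_iff_left (u.isUnit.map _).ne_zero,
      map_multiset_prod, Multiset.prod_eq_zero_iff, Multiset.mem_map] at hx
    obtain ⟨P, hPm, hP⟩ := hx
    exact ⟨P, hm P hPm, hu ▸ (Multiset.dvd_prod hPm).mul_right _, by rwa [polyEval_apply]⟩
  have hprime : (Ideal.span {P}).IsPrime := (Ideal.span_singleton_prime hP.ne_zero).2 hP
  -- By the Nullstellensatz the prime ideal `(P)` consists of the polynomials vanishing on the zeros
  -- of `P`, and these zeros lie in the union of the `U i`. Primality then singles out one `i`.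
  have hle : ∏ i ∈ s, vanishingIdeal ℂ ((fun v : V => ⇑(b.repr v)) '' (U i : Set V)) ≤
      Ideal.span {P} := by
    rw [← IsPrime.vanishingIdeal_zeroLocus (K := ℂ) (Ideal.span {P})]
    intro p hp y hy
    have hPy : polyEval b P (b.equivFun.symm y) = 0 := by
      rw [polyEval_apply, repr_equivFun_symm, ← coe_aeval_eq_eval]
      exact hy P (Ideal.mem_span_singleton_self P)
    obtain ⟨i, hi, hyi⟩ := hU (b.equivFun.symm y) (by
      obtain ⟨q, rfl⟩ := hPJ
      rw [map_mul, Pi.mul_apply, hPy, zero_mul])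
    exact Ideal.le_of_dvd (Finset.dvd_prod_of_mem _ hi) hp y ⟨_, hyi, repr_equivFun_symm b y⟩
  obtain ⟨i, hi, hiP⟩ := hprime.prod_le.1 hle
  have hdvd : ∀ φ ∈ (U i).dualAnnihilator, P ∣ linForm b φ := by
    intro φ hφ
    rw [← Ideal.mem_span_singleton]
    refine hiP ?_
    rintro _ ⟨u, hu, rfl⟩
    have h0 := (Submodule.mem_dualAnnihilator φ).1 hφ u hu
    rwa [← polyEval_linForm b φ, polyEval_apply, ← coe_aeval_eq_eval] at h0
  refine ⟨i, hi, ?_, ?_⟩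
  · rw [← Subspace.forall_mem_dualAnnihilator_apply_eq_zero_iff]
    intro φ hφ
    obtain ⟨q, hq⟩ := hdvd φ hφ
    rw [← polyEval_linForm b φ, hq, map_mul, Pi.mul_apply, hPx, zero_mul]
  · have h1 : Module.finrank ℂ (U i).dualAnnihilator ≤ 1 := by
      by_cases h0 : ∀ φ ∈ (U i).dualAnnihilator, φ = 0
      · rw [(Submodule.eq_bot_iff _).2 h0, finrank_bot]
        exact zero_le_one
      push Not at h0
      obtain ⟨φ₀, hφ₀, hne⟩ := h0
      -- As `P` is not constant, a nonzero linear form divisible by `P` is a constant multiple of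
      -- `P`. So the forms vanishing on `U i` are all proportional.
      have hPdeg : P.totalDegree ≠ 0 := by
        intro hdeg
        rw [totalDegree_eq_zero_iff_eq_C] at hdeg
        rw [hdeg, polyEval_apply, eval_C] at hPx
        exact hP.ne_zero (by rw [hdeg, hPx, C_0])
      have hconst : ∀ φ ∈ (U i).dualAnnihilator, ∃ c, linForm b φ = P * C c := by
        intro φ hφ
        by_cases hz : φ = 0
        · exact ⟨0, by simp [hz, linForm]⟩
        obtain ⟨q, hq⟩ := hdvd φ hφ
        have hl := linForm_ne_zero b hz
        have hdeg := (isHomogeneous_linForm b φ).totalDegree hl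
        have hq0 : q ≠ 0 := by
          rintro rfl
          exact hl (hq.trans (mul_zero _))
        rw [hq, totalDegree_mul_of_isDomain hP.ne_zero hq0] at hdeg
        exact ⟨_, hq.trans (congrArg _ (totalDegree_eq_zero_iff_eq_C.1 (by omega)))⟩
      obtain ⟨c₀, hc₀⟩ := hconst φ₀ hφ₀
      have hc₀' : c₀ ≠ 0 := by
        rintro rfl
        exact linForm_ne_zero b hne (by rw [hc₀, C_0, mul_zero])
      refine finrank_le_one ⟨φ₀, hφ₀⟩ fun φ => ?_
      obtain ⟨c, hc⟩ := hconst φ φ.2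
      refine ⟨c / c₀, Subtype.ext (linForm_injective b ?_)⟩
      change linForm b ((c / c₀) • φ₀) = _
      rw [linForm_smul, hc₀, hc, mul_left_comm, ← C_mul, div_mul_cancel₀ _ hc₀']
    have := Subspace.finrank_add_finrank_dualAnnihilator_eq (U i)
    omega

end Coordinates

end ReflBundle

/-! ### Differentials of invariants and freeness of the action. -/

namespace ReflBundle

section Differentials

variable {V : Type*} [NormedAddCommGroup V] [NormedSpace ℂ V] [FiniteDimensional ℂ V]

theorem contDiff_of_mem_polyFun {g : V → ℂ} (hg : g ∈ polyFun V) : ContDiff ℂ ω g := by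
  induction hg using Algebra.adjoin_induction with
  | mem g hg =>
    obtain ⟨φ, rfl⟩ := hg
    exact (LinearMap.toContinuousLinearMap φ).contDiff
  | algebraMap c => exact contDiff_const
  | add g h _ _ hg hh => exact hg.add hh
  | mul g h _ _ hg hh => exact hg.mul hh

theorem differentiable_of_mem_polyFun {g : V → ℂ} (hg : g ∈ polyFun V) : Differentiable ℂ g :=
  (contDiff_of_mem_polyFun hg).differentiable (by simp)

theorem fderiv_polyEval {n : ℕ} (b : Module.Basis (Fin n) ℂ V) (p : MvPolynomial (Fin n) ℂ) (v : V)
    (j : Fin n) :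
    fderiv ℂ (polyEval b p) v (b j) = polyEval b (MvPolynomial.pderiv j p) v := by
  have hd : ∀ q, DifferentiableAt ℂ (polyEval b q) v := fun q =>
    differentiable_of_mem_polyFun (range_polyEval b ▸ ⟨q, rfl⟩) v
  induction p using MvPolynomial.induction_on with
  | C a =>
    have : polyEval b (MvPolynomial.C a) = fun _ => a := by
      ext v
      rw [polyEval_apply, MvPolynomial.eval_C]
    simp [this]
  | add p q hp hq =>
    rw [map_add, fderiv_add (hd p) (hd q), add_apply, hp, hq, map_add, map_add,
      Pi.add_apply]
  | mul_X p i hp =>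
    have hX : fderiv ℂ (polyEval b (MvPolynomial.X i)) v (b j) =
        polyEval b (MvPolynomial.pderiv j (MvPolynomial.X i)) v := by
      rw [← linForm_coord b i, polyEval_linForm, linForm_coord, MvPolynomial.pderiv_X]
      have h1 := (LinearMap.toContinuousLinearMap (b.coord i)).fderiv (x := v)
      change fderiv ℂ (LinearMap.toContinuousLinearMap (b.coord i)) v (b j) = _
      rw [h1, polyEval_apply]
      by_cases hij : i = j
      · subst hij; simp
      · simp [hij]
    rw [map_mul, fderiv_mul (hd p) (hd _)]
    simp only [add_apply, smul_apply, hp, hX,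
      Derivation.leibniz, map_add, smul_eq_mul, map_mul, Pi.add_apply, Pi.mul_apply]

variable (W : Subgroup (LinearMap.GeneralLinearGroup ℂ V)) [Finite W]

/-- At a point with trivial stabilizer the differentials of the invariants separate vectors. -/
theorem exists_invariant_fderiv_ne_zero {x u : V} (hx : ∀ w : W, w • x = x → w = 1) (hu : u ≠ 0) :
    ∃ g ∈ invariantAlgebra W, fderiv ℂ g x u ≠ 0 := by
  classical
  cases nonempty_fintype W
  have hsep : ∀ w : W, ∃ φ : Module.Dual ℂ V, w ≠ 1 → φ x - φ (w • x) ≠ 0 := by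
    intro w
    by_cases hw : w = 1
    · exact ⟨0, fun h => absurd hw h⟩
    have h1 : x - w • x ≠ 0 := fun h0 => hw (hx w (sub_eq_zero.1 h0).symm)
    obtain ⟨φ, hφ⟩ := not_forall.1 (mt (Module.forall_dual_apply_eq_zero_iff ℂ _).1 h1)
    exact ⟨φ, fun _ => by rwa [← map_sub]⟩
  choose φ hφ using hsep
  obtain ⟨ψ, hψ⟩ := not_forall.1 (mt (Module.forall_dual_apply_eq_zero_iff ℂ u).1 hu)
  have haff : ∀ (χ : Module.Dual ℂ V) (c : ℂ), (fun v => χ v - c) ∈ polyFun V := fun χ c =>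
    sub_mem (Algebra.subset_adjoin ⟨χ, rfl⟩) (Subalgebra.algebraMap_mem _ c)
  have hdiff : ∀ (χ : Module.Dual ℂ V) (c : ℂ), Differentiable ℂ fun v => χ v - c := fun χ c =>
    differentiable_of_mem_polyFun (haff χ c)
  set q : W → V → ℂ := fun w v => φ w v - φ w (w • x) with hq
  -- At `x` the differential of `p` is a nonzero multiple of `ψ`. At `w x` with `w ≠ 1` the square
  -- of `q w` makes `p` vanish to second order, so only `w = 1` contributes to the differential of
  -- the sum over `W`.
  set p : V → ℂ := (fun v => ψ v - ψ x) * ∏ w ∈ Finset.univ.erase 1, q w ^ 2 with hp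
  have hp_mem : p ∈ polyFun V := mul_mem (haff ψ _) (prod_mem fun w _ => pow_mem (haff _ _) 2)
  have hcomp : ∀ w : W, HasFDerivAt (fun v => p (w • v))
      ((fderiv ℂ p (w • x)).comp (LinearMap.toContinuousLinearMap
        (w : LinearMap.GeneralLinearGroup ℂ V).1)) x := fun w =>
    (differentiable_of_mem_polyFun hp_mem (w • x)).hasFDerivAt.comp x
      (LinearMap.toContinuousLinearMap (w : LinearMap.GeneralLinearGroup ℂ V).1).hasFDerivAt
  refine ⟨fun v => ∑ w : W, p (w • v), ⟨?_, fun w' v => ?_⟩, ?_⟩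
  · have : (fun v => ∑ w : W, p (w • v)) = ∑ w : W, fun v => p (w • v) := by
      ext v
      simp
    rw [this]
    exact sum_mem fun w _ => comp_mem_polyFun hp_mem (w : LinearMap.GeneralLinearGroup ℂ V).1
  · refine Fintype.sum_bijective (· * w') (Group.mulRight_bijective w') _ _ fun w => ?_
    rw [mul_smul]
  · have h1 := HasFDerivAt.fun_sum (u := Finset.univ) fun w _ => hcomp w
    rw [h1.fderiv, sum_apply, Finset.sum_eq_single 1]
    · have h2 : p = (fun v => ψ v - ψ x) * (∏ w ∈ Finset.univ.erase 1, q w ^ 2) := rfl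
      have hprod : DifferentiableAt ℂ (∏ w ∈ Finset.univ.erase 1, q w ^ 2) x :=
        differentiable_of_mem_polyFun (prod_mem fun w _ => pow_mem (haff _ _) 2) x
      have hψd : fderiv ℂ (fun v => ψ v - ψ x) x = LinearMap.toContinuousLinearMap ψ := by
        rw [fderiv_sub_const]
        exact (LinearMap.toContinuousLinearMap ψ).fderiv
      rw [one_smul, h2, fderiv_mul (hdiff ψ _ x) hprod, hψd]
      simp only [ContinuousLinearMap.comp_apply, add_apply,
        smul_apply, sub_self, smul_eq_mul]
      rw [zero_mul, zero_add]
      refine mul_ne_zero ?_ hψ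
      rw [Finset.prod_apply]
      exact Finset.prod_ne_zero_iff.2 fun w hw => pow_ne_zero 2 (hφ w (Finset.ne_of_mem_erase hw))
    · intro w _ hw
      have h2 : ∃ r ∈ polyFun V, p = q w * q w * r := by
        refine ⟨(fun v => ψ v - ψ x) * ∏ w' ∈ (Finset.univ.erase 1).erase w, q w' ^ 2,
          mul_mem (haff ψ _) (prod_mem fun w _ => pow_mem (haff _ _) 2), ?_⟩
        rw [hp, ← Finset.mul_prod_erase _ _ (Finset.mem_erase.2 ⟨hw, Finset.mem_univ w⟩)]
        ring
      obtain ⟨r, hr, hpr⟩ := h2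
      have hqd : DifferentiableAt ℂ (q w) (w • x) := hdiff _ _ _
      have hq0 : q w (w • x) = 0 := sub_self _
      rw [hpr, fderiv_mul (hqd.mul hqd) (differentiable_of_mem_polyFun hr _), fderiv_mul hqd hqd]
      simp [hq0]
    · simp

variable {W} {n : ℕ}

/-- By the Leibniz rule, a vector killed by the differentials of the generators is killed by that of
every invariant. -/
theorem eq_zero_of_fderiv_eq_zero_of_stabilizer {f : Fin n → V → ℂ} (hf : IsBasicInvariants W f)
    {x u : V} (hx : ∀ w : W, w • x = x → w = 1) (hu : ∀ i, fderiv ℂ (f i) x u = 0) : u = 0 := by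
  have key : ∀ g ∈ invariantAlgebra W, DifferentiableAt ℂ g x ∧ fderiv ℂ g x u = 0 := by
    intro g hg
    rw [← hf.2] at hg
    induction hg using Algebra.adjoin_induction with
    | mem g hg =>
      obtain ⟨i, rfl⟩ := hg
      exact ⟨differentiable_of_mem_polyFun (mem_polyFun_of_isBasicInvariants hf i) x, hu i⟩
    | algebraMap c =>
      have h0 : fderiv ℂ (fun _ : V => c) x = 0 := fderiv_const_apply c
      exact ⟨differentiableAt_const c, DFunLike.congr_fun h0 u⟩
    | add g h _ _ hg hh =>
      refine ⟨hg.1.add hh.1, ?_⟩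
      rw [fderiv_add hg.1 hh.1, add_apply, hg.2, hh.2, add_zero]
    | mul g h _ _ hg hh =>
      refine ⟨hg.1.mul hh.1, ?_⟩
      rw [fderiv_mul hg.1 hh.1, add_apply, smul_apply, smul_apply, hg.2, hh.2, smul_zero,
        smul_zero, add_zero]
  by_contra hne
  obtain ⟨g, hg, hgu⟩ := exists_invariant_fderiv_ne_zero W hx hne
  exact hgu (key g hg).2

/-- The differential of the basic invariants is injective off the reflecting hyperplanes. -/
theorem eq_zero_of_fderiv_eq_zero (b : Module.Basis (Fin n) ℂ V) {f : Fin n → V → ℂ}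
    (hf : IsBasicInvariants W f) {x : V} (hx : x ∈ hyperplaneComplement W) {u : V}
    (hu : ∀ i, fderiv ℂ (f i) x u = 0) : u = 0 := by
  classical
  cases nonempty_fintype W
  have hpoly : ∀ i, ∃ p, polyEval b p = f i := fun i => by
    have := mem_polyFun_of_isBasicInvariants hf i
    rwa [← range_polyEval b] at this
  choose p hp using hpoly
  set J : MvPolynomial (Fin n) ℂ := (Matrix.of fun i j => MvPolynomial.pderiv j (p i)).det with hJ
  have hJv : ∀ v, polyEval b J v = (Matrix.of fun i j => fderiv ℂ (f i) v (b j)).det := by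
    intro v
    rw [polyEval_apply, hJ, RingHom.map_det]
    congr 1
    ext i j
    simp [← hp, fderiv_polyEval, polyEval_apply]
  have hker : ∀ v, polyEval b J v = 0 ↔ ∃ u ≠ 0, ∀ i, fderiv ℂ (f i) v u = 0 := by
    intro v
    rw [hJv, ← Matrix.exists_mulVec_eq_zero_iff]
    have hsum : ∀ (y : Fin n → ℂ) i, fderiv ℂ (f i) v (b.equivFun.symm y) =
        Matrix.mulVec (Matrix.of fun i j => fderiv ℂ (f i) v (b j)) y i := by
      intro y i
      simp [Module.Basis.equivFun_symm_apply, Matrix.mulVec, dotProduct, mul_comm]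
    constructor
    · rintro ⟨y, hy, h⟩
      exact ⟨b.equivFun.symm y, (map_ne_zero_iff _ b.equivFun.symm.injective).2 hy, fun i => by rw [hsum, h, Pi.zero_apply]⟩
    · rintro ⟨u, hu, h⟩
      refine ⟨b.equivFun u, by simpa using hu, funext fun i => ?_⟩
      rw [← hsum, LinearEquiv.symm_apply_apply, h, Pi.zero_apply]
  have hstab : ∀ v, polyEval b J v = 0 → ∃ w ∈ Finset.univ.erase (1 : W),
      v ∈ fixedSpace (w : LinearMap.GeneralLinearGroup ℂ V) := by
    intro v hv
    obtain ⟨u, hu0, hu⟩ := (hker v).1 hv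
    by_contra! hcon
    refine hu0 (eq_zero_of_fderiv_eq_zero_of_stabilizer hf (fun w hw => ?_) hu)
    by_contra hne
    exact hcon w (Finset.mem_erase.2 ⟨hne, Finset.mem_univ w⟩) ((mem_fixedSpace _ _).2 hw)
  have htop : ∀ w : W, w ≠ 1 → fixedSpace (w : LinearMap.GeneralLinearGroup ℂ V) ≠ ⊤ := by
    intro w hw h
    refine hw (Subtype.ext (Units.ext (LinearMap.ext fun v => ?_)))
    exact (mem_fixedSpace _ _).1 (h ▸ Submodule.mem_top : v ∈ _)
  -- If `J` were zero, `hstab` would cover `V` by finitely many proper subspaces.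
  have hJ0 : J ≠ 0 := by
    intro h0
    have := Subspace.biUnion_ne_univ_of_top_notMem (k := ℂ) (E := V)
      (s := (Finset.univ.erase (1 : W)).image
        fun w : W => fixedSpace (w : LinearMap.GeneralLinearGroup ℂ V)) (by
        simp only [Finset.mem_image, not_exists, not_and]
        exact fun w hw => htop w (Finset.ne_of_mem_erase hw))
    refine this (Set.eq_univ_of_forall fun v => ?_)
    obtain ⟨w, hw, hv⟩ := hstab v (by simp [h0])
    exact Set.mem_biUnion (Finset.mem_coe.2 (Finset.mem_image_of_mem _ hw)) hv
  by_contra hne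
  obtain ⟨w, hw, hxw, hfin⟩ := exists_finrank_le_of_zeros_subset b hJ0 ((hker x).2 ⟨u, hne, hu⟩)
    _ _ hstab
  -- The fixed space is proper and of codimension at most one, so `w` is a reflection and `x` lies
  -- on its hyperplane.
  have hlt := Submodule.finrank_lt (htop w (Finset.ne_of_mem_erase hw))
  refine hx (Set.mem_biUnion (x := fixedSpace (w : LinearMap.GeneralLinearGroup ℂ V))
    ⟨w, w.2, ⟨?_, by omega⟩, rfl⟩ hxw)
  exact W.subtype.isOfFinOrder (isOfFinOrder_of_finite w)

/-- Steinberg's theorem: `W` acts freely off the reflecting hyperplanes. -/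
theorem eq_one_of_smul_eq (hW : IsReflectionGroup W) {x : V} (hx : x ∈ hyperplaneComplement W)
    {w : W} (hw : w • x = x) : w = 1 := by
  obtain ⟨f, hf⟩ := exists_isBasicInvariants W (Module.finBasis ℂ V) hW
  refine Subtype.ext (Units.ext (LinearMap.ext fun v => sub_eq_zero.1 ?_))
  refine eq_zero_of_fderiv_eq_zero (Module.finBasis ℂ V) hf hx fun i => ?_
  have hmem : f i ∈ invariantAlgebra W := hf.2 ▸ Algebra.subset_adjoin ⟨i, rfl⟩
  -- Differentiating `f i ∘ w = f i` at the fixed point `x` shows that every `w v - v` lies in the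
  -- kernel of the differential of `f i` at `x`.
  have h1 : HasFDerivAt (f i) (fderiv ℂ (f i) x) (w • x) := by
    rw [hw]
    exact (differentiable_of_mem_polyFun hmem.1 x).hasFDerivAt
  have h2 := (HasFDerivAt.comp x h1 (LinearMap.toContinuousLinearMap
    (w : LinearMap.GeneralLinearGroup ℂ V).1).hasFDerivAt).fderiv
  have h3 : f i ∘ HSMul.hSMul w = f i :=
    funext fun v => hmem.2 w v
  rw [h3] at h2
  rw [map_sub, sub_eq_zero]
  exact (DFunLike.congr_fun h2 v).symm

theorem isCancelSMul_hyperplaneComplement (hW : IsReflectionGroup W) :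
    IsCancelSMul W (hyperplaneComplement W) :=
  isCancelSMul_iff_eq_one_of_smul_eq.2 fun _ x hw =>
    eq_one_of_smul_eq hW x.2 (congrArg Subtype.val hw)

end Differentials

end ReflBundle

/-! ### Trivialization of the quotient bundle. -/

namespace ReflBundle

section Trivialization

variable {V : Type*} [NormedAddCommGroup V] [NormedSpace ℂ V] [FiniteDimensional ℂ V]
variable (W : Subgroup (LinearMap.GeneralLinearGroup ℂ V)) [Finite W]

theorem contMDiff_smul_hyperplaneComplement (w : W) :
    ContMDiff 𝓘(ℂ, V) 𝓘(ℂ, V) ω fun x : hyperplaneComplement W => w • x := by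
  have h : ContMDiff 𝓘(ℂ, V) 𝓘(ℂ, V) ω
      (Subtype.val ∘ fun x : hyperplaneComplement W => w • x) := (LinearMap.toContinuousLinearMap
    (w : LinearMap.GeneralLinearGroup ℂ V).1).contDiff.contMDiff.comp contMDiff_subtype_val
  exact fun x => (ChartedSpace.liftPropWithinAt_subtypeVal_comp_iff ..).1 (h x)

theorem contMDiff_smul_prod (w : W) :
    ContMDiff (𝓘(ℂ, V).prod 𝓘(ℂ, V)) (𝓘(ℂ, V).prod 𝓘(ℂ, V)) ω
      fun p : hyperplaneComplement W × V => w • p :=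
  ((contMDiff_smul_hyperplaneComplement W w).comp contMDiff_fst).prodMk
    ((LinearMap.toContinuousLinearMap
      (w : LinearMap.GeneralLinearGroup ℂ V).1).contDiff.contMDiff.comp contMDiff_snd)

variable {W} {D : V → V →L[ℂ] V}

/-- Inversion of operators is analytic at invertible ones; this makes the inverse trivialization
holomorphic. -/
theorem contMDiff_inverse_apply (hD : ContDiff ℂ ω D)
    (hinv : ∀ x ∈ hyperplaneComplement W, (D x).IsInvertible) :
    ContMDiff (𝓘(ℂ, V).prod 𝓘(ℂ, V)) 𝓘(ℂ, V) ω
      fun p : hyperplaneComplement W × V => (D p.1).inverse p.2 := by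
  intro p
  refine ContMDiffAt.clm_apply ?_ contMDiffAt_snd
  have h1 : ContMDiffAt 𝓘(ℂ, V) 𝓘(ℂ, V →L[ℂ] V) ω (fun y => (D y).inverse) (p.1 : V) :=
    ((hinv p.1 p.1.2).contDiffAt_map_inverse.comp (p.1 : V) hD.contDiffAt).contMDiffAt
  exact h1.comp p (contMDiff_subtype_val.comp
    (contMDiff_fst : ContMDiff (𝓘(ℂ, V).prod 𝓘(ℂ, V)) 𝓘(ℂ, V) ω
      (Prod.fst : hyperplaneComplement W × V → hyperplaneComplement W))).contMDiffAt

variable [IsCancelSMul W (hyperplaneComplement W)]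

/-- The trivialization `[x, v] ↦ ([x], D x v)` of the quotient bundle defined by a holomorphic,
pointwise invertible, invariant family of endomorphisms, as a biholomorphic map. -/
noncomputable def diffeomorphOfInvariant (hD : ContDiff ℂ ω D)
    (hinv : ∀ x ∈ hyperplaneComplement W, (D x).IsInvertible)
    (hW : ∀ (w : W) (x v : V), D (w • x) (w • v) = D x v) :
    Total W ≃ₘ^ω⟮𝓘(ℂ, V).prod 𝓘(ℂ, V), 𝓘(ℂ, V).prod 𝓘(ℂ, V)⟯ (Base W × V) :=
  have hl : ∀ x : hyperplaneComplement W, ∀ v, (D x).inverse (D x v) = v := fun x v => by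
    obtain ⟨e, he⟩ := hinv x x.2
    simp [← he]
  have hr : ∀ x : hyperplaneComplement W, ∀ v, D x ((D x).inverse v) = v := fun x v => by
    obtain ⟨e, he⟩ := hinv x x.2
    simp [← he]
  { toFun := Quotient.lift (fun p => (mkBase W p.1, D p.1 p.2)) <| by
      rintro _ p ⟨w, rfl⟩
      exact Prod.ext (Quotient.sound ⟨w, rfl⟩) (hW w p.1 p.2)
    invFun := fun q => Quotient.lift (fun x : hyperplaneComplement W =>
      mkTotal W x ((D x).inverse q.2)) (by
        rintro _ x ⟨w, rfl⟩
        refine Quotient.sound ⟨w, Prod.ext rfl ?_⟩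
        change w • (D x).inverse q.2 = (D (w • x : hyperplaneComplement W)).inverse q.2
        -- Equivariance of the inverse follows from `hW` by applying `D (w x)` to `w • (D x)⁻¹ u`.
        rw [← hl (w • x) (w • (D x).inverse q.2), coe_smul, hW, hr]) q.1
    left_inv := by
      intro e
      induction e using Quotient.inductionOn with
      | h p => exact congrArg (mkTotal W p.1) (hl p.1 p.2)
    right_inv := by
      rintro ⟨q, v⟩
      induction q using Quotient.inductionOn with
      | h x => exact Prod.ext rfl (hr x v)
    contMDiff_toFun := by
      intro e
      induction e using Quotient.inductionOn with
      | h p =>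
        refine MulAction.contMDiffAt_of_comp_quotientMk (contMDiff_smul_prod W) ?_
        have h1 : ContMDiff (𝓘(ℂ, V).prod 𝓘(ℂ, V)) 𝓘(ℂ, V) ω
            fun p : hyperplaneComplement W × V => D p.1 p.2 :=
          (hD.contMDiff.comp (contMDiff_subtype_val.comp contMDiff_fst)).clm_apply contMDiff_snd
        exact (((MulAction.contMDiff_quotientMk (contMDiff_smul_hyperplaneComplement W)).comp
          contMDiff_fst).prodMk h1).contMDiffAt
    contMDiff_invFun := by
      rintro ⟨q, v⟩
      induction q using Quotient.inductionOn with
      | h x =>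
        refine MulAction.contMDiffAt_prod_of_comp_quotientMk
          (contMDiff_smul_hyperplaneComplement W) ?_
        exact ((MulAction.contMDiff_quotientMk (contMDiff_smul_prod W)).comp
          (contMDiff_fst.prodMk (contMDiff_inverse_apply hD hinv))).contMDiffAt }

theorem diffeomorphOfInvariant_mkTotal (hD : ContDiff ℂ ω D)
    (hinv : ∀ x ∈ hyperplaneComplement W, (D x).IsInvertible)
    (hW : ∀ (w : W) (x v : V), D (w • x) (w • v) = D x v) (x : hyperplaneComplement W) (v : V) :
    diffeomorphOfInvariant hD hinv hW (mkTotal W x v) = (mkBase W x, D x v) :=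
  rfl

/-- The trivialization `[x, v] ↦ ([x], D x v)` of the quotient bundle. -/
noncomputable def trivializationOfInvariant (hD : ContDiff ℂ ω D)
    (hinv : ∀ x ∈ hyperplaneComplement W, (D x).IsInvertible)
    (hW : ∀ (w : W) (x v : V), D (w • x) (w • v) = D x v) : HolomorphicTrivialization W where
  toDiffeomorph := diffeomorphOfInvariant hD hinv hW
  fst_apply e := by
    induction e using Quotient.inductionOn with
    | h p => exact congrArg Prod.fst (diffeomorphOfInvariant_mkTotal hD hinv hW p.1 p.2)
  linear q := by
    have h1 := fibreEquiv_isLinearMap W q.out q.out_eq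
    have h2 : ∀ e : Fibre W q, ∃ v, fibreEquiv W q.out q.out_eq v = e :=
      (fibreEquiv W q.out q.out_eq).surjective
    have h3 : ∀ v, (diffeomorphOfInvariant hD hinv hW (fibreEquiv W q.out q.out_eq v).1).2 =
        D (q.out : hyperplaneComplement W) v := fun v =>
      congrArg Prod.snd (diffeomorphOfInvariant_mkTotal hD hinv hW q.out v)
    constructor
    · intro e e'
      obtain ⟨v, rfl⟩ := h2 e
      obtain ⟨v', rfl⟩ := h2 e'
      rw [← h1.map_add, h3, h3, h3, map_add]
    · intro c e
      obtain ⟨v, rfl⟩ := h2 e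
      rw [← h1.map_smul, h3, h3, map_smul]

/-- Basic invariants trivialize the quotient bundle. -/
theorem exists_trivialization_of_isBasicInvariants {n : ℕ} (b : Module.Basis (Fin n) ℂ V)
    {f : Fin n → V → ℂ} (hf : IsBasicInvariants W f) :
    ∃ Ψ : HolomorphicTrivialization W, ∀ (x : hyperplaneComplement W) (v : V),
      Ψ.toDiffeomorph (mkTotal W x v) =
        (mkBase W x, fderiv ℂ (fun y : V => ∑ i, f i y • b i) (x : V) v) := by
  have hmem : ∀ i, f i ∈ invariantAlgebra W := fun i => hf.2 ▸ Algebra.subset_adjoin ⟨i, rfl⟩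
  have hF : ContDiff ℂ ω fun y : V => ∑ i, f i y • b i :=
    ContDiff.sum fun i _ => (contDiff_of_mem_polyFun (hmem i).1).smul contDiff_const
  have hd : Differentiable ℂ fun y : V => ∑ i, f i y • b i := hF.differentiable (by simp)
  have hval : ∀ x v : V, fderiv ℂ (fun y : V => ∑ i, f i y • b i) x v =
      ∑ i, fderiv ℂ (f i) x v • b i := by
    intro x v
    have h1 := HasFDerivAt.fun_sum (u := Finset.univ) fun i _ =>
      ((differentiable_of_mem_polyFun (hmem i).1 x).hasFDerivAt.smul_const (b i))
    rw [h1.fderiv, sum_apply]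
    rfl
  have hinv : ∀ x ∈ hyperplaneComplement W,
      (fderiv ℂ (fun y : V => ∑ i, f i y • b i) x).IsInvertible := fun x hx => by
    have hinj : Function.Injective
        (fderiv ℂ (fun y : V => ∑ i, f i y • b i) x : V →ₗ[ℂ] V) := by
      refine (injective_iff_map_eq_zero _).2 fun u hu => ?_
      refine eq_zero_of_fderiv_eq_zero b hf hx fun i => ?_
      have hu' : ∑ i, fderiv ℂ (f i) x u • b i = 0 := (hval x u).symm.trans hu
      exact Fintype.linearIndependent_iff.1 b.linearIndependent _ hu' i
    exact ⟨(LinearEquiv.ofInjectiveEndo _ hinj).toContinuousLinearEquiv,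
      ContinuousLinearMap.ext fun v => rfl⟩
  have hW : ∀ (w : W) (x v : V), fderiv ℂ (fun y : V => ∑ i, f i y • b i) (w • x) (w • v) =
      fderiv ℂ (fun y : V => ∑ i, f i y • b i) x v := fun w x v => by
    have h2 := ((hd (w • x)).hasFDerivAt.comp x (LinearMap.toContinuousLinearMap
      (w : LinearMap.GeneralLinearGroup ℂ V).1).hasFDerivAt).fderiv
    have h3 : (fun y : V => ∑ i, f i y • b i) ∘ HSMul.hSMul w = fun y : V => ∑ i, f i y • b i :=
      funext fun v => by simp only [Function.comp_apply, (hmem _).2 w v]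
    rw [h3] at h2
    exact (DFunLike.congr_fun h2 v).symm
  exact ⟨trivializationOfInvariant (hF.fderiv_right (by simp)) hinv hW,
    diffeomorphOfInvariant_mkTotal (hF.fderiv_right (by simp)) hinv hW⟩

end Trivialization

end ReflBundle

theorem mainTheorem4 {V : Type*} [NormedAddCommGroup V] [NormedSpace ℂ V] [FiniteDimensional ℂ V]
    (W : Subgroup (LinearMap.GeneralLinearGroup ℂ V)) [Finite W]
    (hW : ReflBundle.IsReflectionGroup W) :
    ∃ _ : IsCancelSMul W (ReflBundle.hyperplaneComplement W),
      IsManifold 𝓘(ℂ, V) ω (ReflBundle.Base W) ∧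
      IsManifold (𝓘(ℂ, V).prod 𝓘(ℂ, V)) ω (ReflBundle.Total W) ∧
      Nonempty (ReflBundle.HolomorphicTrivialization W) ∧
      ∀ (n : ℕ) (b : Module.Basis (Fin n) ℂ V),
        (∃ f : Fin n → V → ℂ, ReflBundle.IsBasicInvariants W f) ∧
        ∀ f : Fin n → V → ℂ, ReflBundle.IsBasicInvariants W f →
          ∃ Ψ : ReflBundle.HolomorphicTrivialization W,
            ∀ (x : ReflBundle.hyperplaneComplement W) (v : V),
              Ψ.toDiffeomorph (ReflBundle.mkTotal W x v) =
                (ReflBundle.mkBase W x, fderiv ℂ (fun y : V => ∑ i, f i y • b i) (x : V) v) := by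
  -- Freeness has to come first: the charts of both quotients and the linear structure of the fibres
  -- depend on it.
  have hfree := ReflBundle.isCancelSMul_hyperplaneComplement hW
  refine ⟨hfree, MulAction.isManifold_quotient (ReflBundle.contMDiff_smul_hyperplaneComplement W),
    MulAction.isManifold_quotient (ReflBundle.contMDiff_smul_prod W), ?_, fun n b =>
    ⟨ReflBundle.exists_isBasicInvariants W b hW, fun f hf =>
      ReflBundle.exists_trivialization_of_isBasicInvariants b hf⟩⟩
  obtain ⟨f, hf⟩ := ReflBundle.exists_isBasicInvariants W (Module.finBasis ℂ V) hW
  obtain ⟨Ψ, -⟩ := ReflBundle.exists_trivialization_of_isBasicInvariants (Module.finBasis ℂ V) hf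
  exact ⟨Ψ⟩
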